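/- Let $n\ge 2$, let $q$ be a prime power, $k=\mathrm{GF}(q)\subset K=\mathrm{GF}(q^2)$, and let $V$ be a $2n$-dimensional vector space over $K$ with a nondegenerate alternating $K$-bilinear form $B$. Regard $V$ as a $4n$-dimensional $k$-space and put $\Sigma=\mathrm{PG}(4n-1,q)=\mathrm{PG}(V_k)$. For $a\in K^*$ let $\mathcal W_a$ be the linear complex (symplectic polar space) of $\Sigma$ defined by the form $f_a(x,y)=\mathrm{Tr}_{K/k}(aB(x,y))$; since $\mathcal W_a$ depends only on $ak^*$, this is a pencil of $q+1$ complexes. Let $G\cong\mathrm{PSp}(2n,q^2)$ be the group induced on $\Sigma$ by $\mathrm{Sp}(V,B)$. Let $\mathcal F$ be Dye's spread of $\Sigma$, consisting of the one-dimensional $K$-subspaces of $V$ regarded as lines over $k$. Two lines are conjugate with respect to $\mathcal W_a$ if $f_a$ vanishes on pairs of vectors taken from the one and the other. For a fixed $a\in K^*$, let $\mathcal O_1$ (respectively $\mathcal O_2$) be the set of the totally isotropic lines of $\mathcal W_a$ not in $\mathcal F$ that are conjugate, with respect to $\mathcal W_a$, to no (respectively to every) member of $\mathcal F$ that they meet.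 Embed $\Sigma$ in $\mathrm{PG}(4n-1,q^2)=\mathrm{PG}(K\otimes_k V)$, and let $\tau$ be the involution of $K\otimes_k V$ induced by $x\mapsto x^q$ on $K$. For $b\in K^*$ let $\mathcal H_b$ be the nondegenerate Hermitian variety $\{P: h_b(P,P)=0\}$, where $h_b(x,y)=f_b(x,\tau(y))$ and $f_b$ is extended $K$-bilinearly (up to a nonzero scalar, $h_b$ is a Hermitian form), with unitary polarity $\perp_b$. Let $\theta_{m,Q}=Q^m+\dots+Q+1$. A set $\mathcal X$ of points of $\mathcal H_b$ is an $i$-tight set of $\mathcal H_b$ if, for every point $P$ of $\mathcal H_b$, $$|P^{\perp_b}\cap\mathcal X|=\begin{cases} i\,\theta_{2n-2,q^2}+q^{4n-2} & \text{if } P\in\mathcal X,\\ i\,\theta_{2n-2,q^2} & \text{if } P\notin\mathcal X.\end{cases}$$ For a set $\mathcal L$ of lines of $\Sigma$, the set of points of $\mathcal H_b$ on the extended lines of $\mathcal L$ is the set of points of $\mathcal H_b$ lying on a line of $\mathrm{PG}(4n-1,q^2)$ that is spanned by a line of $\mathcal L$. Then, for every $a\in K^*$, the group $G$ has exactly three orbits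 on the totally isotropic lines of $\mathcal W_a$, namely the pairwise distinct sets $\mathcal F$, $\mathcal O_1$ and $\mathcal O_2$, and the following hold. 1. For every $b\in K^*$, the set of points of $\mathcal H_b$ on the extended lines of $\mathcal F$ is a $(q^2+1)$-tight set of $\mathcal H_b$. 2. The set of points of $\mathcal H_a$ on the extended lines of $\mathcal O_1$ is a $(q^{4n-1}-q^{4n-2}+q+1)$-tight set of $\mathcal H_a$. 3. For every $b\in K^*$, the set of points of $\mathcal H_b$ on the extended lines of $\mathcal O_2$ is a $(q^{4n-2}-q^2+q+1)$-tight set of $\mathcal H_b$. -/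

import Mathlib

open scoped TensorProduct LinearAlgebra.Projectivization

namespace DyeSpread

noncomputable section

/-- `θ_{m,Q} = Q^m + ⋯ + Q + 1`, the number of points of `PG(m,Q)`. -/
def theta (m Q : ℕ) : ℕ := ∑ j ∈ Finset.range (m + 1), Q ^ j

section HermitianGeometry

variable {K E : Type*} [Field K] [AddCommGroup E] [Module K E]

/-- Two points of `PG(E)` are orthogonal for `h`: `h` vanishes on all pairs of representatives. -/
def Orthogonal (h : E → E → K) (P Q : ℙ K E) : Prop :=
  ∀ x ∈ P.submodule, ∀ y ∈ Q.submodule, h x y = 0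

/-- The set of points of the polar hyperplane `P^⊥` of `P` with respect to `h`. -/
def polar (h : E → E → K) (P : ℙ K E) : Set (ℙ K E) := {Q | Orthogonal h P Q}

/-- The variety of a sesquilinear form `h`: the set of the isotropic points. -/
def isotropicPoints (h : E → E → K) : Set (ℙ K E) := {P | Orthogonal h P P}

/-- `X` is an `i`-tight set of the Hermitian variety `H(r,q²)` of `PG(r,q²)`, `r` odd, that is
defined by the form `h`. -/
def IsTight (q r : ℕ) (h : E → E → K) (i : ℕ) (X : Set (ℙ K E)) : Prop :=
  X ⊆ isotropicPoints h ∧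
    ∀ P ∈ isotropicPoints h,
      (P ∈ X → (polar h P ∩ X).ncard = i * theta ((r - 3) / 2) (q ^ 2) + q ^ (r - 1)) ∧
      (P ∉ X → (polar h P ∩ X).ncard = i * theta ((r - 3) / 2) (q ^ 2))

end HermitianGeometry

section Lines

variable {k V : Type*} [Field k] [AddCommGroup V] [Module k V]

/-- The totally isotropic lines of the form `f`; a line of `PG(V)` is a 2-dimensional subspace. -/
def isotropicLines (f : LinearMap.BilinForm k V) : Set (Submodule k V) :=
  {l | Module.finrank k l = 2 ∧ ∀ x ∈ l, ∀ y ∈ l, f x y = 0}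

/-- Two lines are conjugate for `f` if each is contained in the polar space of the other. -/
def Conjugate (f : LinearMap.BilinForm k V) (l m : Submodule k V) : Prop :=
  ∀ x ∈ l, ∀ y ∈ m, f x y = 0

/-- The set of points of `PG(K ⊗ V)` lying on the extended lines of `L`. -/
def extendedPoints (K : Type*) [Field K] [Algebra k K] (L : Set (Submodule k V)) :
    Set (ℙ K (K ⊗[k] V)) :=
  {P | ∃ l ∈ L, P.submodule ≤ l.baseChange K}

end Lines

section Pencil

variable (k : Type*) {K V : Type*} [Field k] [Field K] [Algebra k K]
  [AddCommGroup V] [Module K V] [Module k V] [IsScalarTower k K V]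

/-- The `k`-bilinear form `(x, y) ↦ Tr_{K/k}(a B(x,y))` on `V`. For `B` alternating and
nondegenerate, the forms with `a ≠ 0` define the pencil of linear complexes `W_i`; two of them
define the same complex exactly when the values of `a` are proportional over `k`. -/
def pencilForm (B : LinearMap.BilinForm K V) (a : K) : LinearMap.BilinForm k V :=
  LinearMap.mk₂ k (fun x y => Algebra.trace k K (a * B x y))
    (fun x y z => by simp [mul_add])
    (fun c x y => by
      rw [← algebraMap_smul K c x, map_smul, LinearMap.smul_apply, smul_eq_mul, mul_left_comm,
        ← Algebra.smul_def, map_smul])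
    (fun x y z => by simp [mul_add])
    (fun c x y => by
      rw [← algebraMap_smul K c y, map_smul, smul_eq_mul, mul_left_comm,
        ← Algebra.smul_def, map_smul])

/-- The spread `F`: the one-dimensional `K`-subspaces of `V`, regarded as lines over `k`. -/
def spread (K V : Type*) [Field K] [Algebra k K] [AddCommGroup V] [Module K V] [Module k V]
    [IsScalarTower k K V] : Set (Submodule k V) :=
  {l | ∃ v : V, v ≠ 0 ∧ l = (Submodule.span K {v}).restrictScalars k}

/-- The totally isotropic lines of `W_a` outside `F` that are conjugate to no member of `F` that
they meet. -/
def lineSetOne (B : LinearMap.BilinForm K V) (a : K) : Set (Submodule k V) :=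
  {l | l ∈ isotropicLines (pencilForm k B a) ∧ l ∉ spread k K V ∧
    ∀ m ∈ spread k K V, l ⊓ m ≠ ⊥ → ¬ Conjugate (pencilForm k B a) l m}

/-- The totally isotropic lines of `W_a` outside `F` that are conjugate to each member of `F` that
they meet. -/
def lineSetTwo (B : LinearMap.BilinForm K V) (a : K) : Set (Submodule k V) :=
  {l | l ∈ isotropicLines (pencilForm k B a) ∧ l ∉ spread k K V ∧
    ∀ m ∈ spread k K V, l ⊓ m ≠ ⊥ → Conjugate (pencilForm k B a) l m}

/-- The group `Sp(V, B)` of `K`-linear isometries of `B`. -/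
def symplecticGroup (B : LinearMap.BilinForm K V) : Subgroup (V ≃ₗ[K] V) where
  carrier := {g | ∀ x y, B (g x) (g y) = B x y}
  mul_mem' := fun {g h} hg hh x y => by
    rw [LinearEquiv.mul_apply, LinearEquiv.mul_apply, hg, hh]
  one_mem' := fun _ _ => rfl
  inv_mem' := fun {g} hg x y => by
    have := hg (g⁻¹ x) (g⁻¹ y)
    rw [← LinearEquiv.mul_apply, ← LinearEquiv.mul_apply, mul_inv_cancel] at this
    exact this.symm

/-- The orbits of the group induced by `Sp(V, B)` on `PG(V)` over `k` (this group is
`G ≅ PSp(2n,q²)`) on the totally isotropic lines of `W_a`. -/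
def isotropicLineOrbits (B : LinearMap.BilinForm K V) (a : K) : Set (Set (Submodule k V)) :=
  {O | ∃ l ∈ isotropicLines (pencilForm k B a),
    O = {l' | ∃ g ∈ symplecticGroup B, l' = l.map ((g : V →ₗ[K] V).restrictScalars k)}}

variable (K V) in
/-- The semilinear involution `τ` of `K ⊗ V` that fixes `PG(V)` pointwise: it raises the scalars in
`K` to the power `|k|`. -/
def tau [Fintype k] : K ⊗[k] V →ₗ[k] K ⊗[k] V :=
  TensorProduct.map (FiniteField.frobeniusAlgHom k K).toLinearMap LinearMap.id

/-- The form `h(x, y) = f(x, τ y)` on `K ⊗ V`, where `f` is the `K`-bilinear extension of the form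
of `W_a`. It is skew-Hermitian: `ε h` is a Hermitian form for every `ε ≠ 0` with `ε^q = -ε`, with
the same isotropic points and the same polarity. It defines the Hermitian variety `H_a`. -/
def hermitianForm [Fintype k] (B : LinearMap.BilinForm K V) (a : K) :
    K ⊗[k] V → K ⊗[k] V → K :=
  fun x y => (pencilForm k B a).baseChange K x (tau k K V y)

/-- The set of points of `H_a` lying on the extended lines of `L`. -/
def hermitianPoints [Fintype k] (B : LinearMap.BilinForm K V) (a : K) (L : Set (Submodule k V)) :
    Set (ℙ K (K ⊗[k] V)) :=
  isotropicPoints (hermitianForm k B a) ∩ extendedPoints K L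

end Pencil

end

end DyeSpread

/-!
Let `q = |k|` and fix `ω ∈ K` outside `k`. Every vector of `K ⊗ V` is `1 ⊗ u + ω ⊗ v` for unique
`u, v ∈ V` (`tensorPair_bijective`), and it lies on the extension of a line `l` of `PG(V)` if and
only if `u, v ∈ l`. It is isotropic for `h_b` if and only if `Tr(b B(u, v)) = 0`.

*Orbits.* A line spanned over `k` by `u` and `v` belongs to the spread if `u, v` are dependent over
`K`, to the second set if they are independent and `B(u, v) = 0`, and to the first set if `B(u, v)
≠ 0`. By Witt's theorem for pairs of vectors, proved with transvections
(`exists_symplectic_apply_pair_eq`), the symplectic group is transitive on each kind; for the first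
set, `a B(u, v)` is a nonzero element of trace zero; these elements are proportional over `k`, so
that `B(u, v)` can be given a prescribed value by rescaling `v` over `k`.

*Tight sets.* Consider four sets of vectors of `K ⊗ V`, each containing the next: the isotropic
vectors of `h_a`; the vectors with `B(u, v) = 0`, which are those isotropic for the whole pencil;
those with `u, v` dependent over `K`, which lie on the extended lines of the spread; and those with
`u, v` dependent over `k`, which lie on the points of `PG(V)`. With `M = q ^ (4n-2)` they are tight
with parameters `q M + 1`, `M + 1`, `q² + 1` and `q + 1`. Every point of `PG(V)` lies on lines of
each orbit. Hence the vectors on the extended lines of the first orbit are obtained by removing the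
second of the four sets from the first and adding the fourth, and those of the second orbit by
removing the third from the second and adding the fourth. Tightness is additive in this sense
(`IsTightCone.sdiff_union`).

The last two parameters come from a double count over the lines of the spread of the
one-dimensional subspaces over `K` or over `k` (`ncard_spreadCone_polar`). The first comes from the
size of a tangent hyperplane section of a Hermitian variety. For the second, a vector with `B(u, v)
≠ 0` is isotropic for exactly one of the `q + 1` members of the pencil, so that the sizes of the
sections of all members by the polar hyperplane of `P` add up to the size of this hyperplane plus
`q` times the wanted number. The polar hyperplane of `P` is tangent to all members if `P` lies on
all of them, and to just one otherwise (`isTightCone_pencilCone`).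
-/

namespace DyeSpread

/-! ### Counting by indicator sums -/

section Counting

variable {α β : Type*} [Fintype α] [Fintype β]

theorem ncard_setOf_eq_sum (P : α → Prop) [DecidablePred P] :
    ({x | P x}.ncard : ℤ) = ∑ x, if P x then 1 else 0 := by
  classical
  rw [Finset.sum_boole, Set.ncard_eq_toFinset_card']
  congr 2
  ext x
  simp

theorem sum_ncard_comm (R : α → β → Prop) :
    ∑ a, ({b | R a b}.ncard : ℤ) = ∑ b, ({a | R a b}.ncard : ℤ) := by
  classical
  simp only [ncard_setOf_eq_sum]
  exact Finset.sum_comm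

theorem sum_ite_const (P : α → Prop) [DecidablePred P] (m n : ℤ) :
    ∑ a, (if P a then m else n) = {a | P a}.ncard * (m - n) + Fintype.card α * n := by
  have h : ∀ a, (if P a then m else n) = (if P a then 1 else 0) * (m - n) + n := by
    intro a
    split_ifs <;> ring
  simp_rw [h]
  rw [Finset.sum_add_distrib, ← Finset.sum_mul, ← ncard_setOf_eq_sum]
  simp

end Counting

/-! ### The quadratic extension `K / k` of finite fields -/

section Quadratic

variable (k K : Type*) [Field k] [Fintype k] [Field K] [Algebra k K]

/-- The automorphism `x ↦ x^q` of `K` over `k`, where `q = |k|`. -/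
noncomputable abbrev frob : K →ₐ[k] K := FiniteField.frobeniusAlgHom k K

variable {k K}

omit [Fintype k] in
theorem finiteDimensional_of_finrank_two (hK : Module.finrank k K = 2) : Module.Finite k K :=
  Module.finite_of_finrank_pos (by omega)

theorem card_of_finrank_two [Fintype K] (hK : Module.finrank k K = 2) :
    Fintype.card K = Fintype.card k ^ 2 := by
  rw [← hK]
  exact Module.card_eq_pow_finrank

theorem frob_frob (hK : Module.finrank k K = 2) (z : K) : frob k K (frob k K z) = z := by
  have := finiteDimensional_of_finrank_two hK
  have : Finite K := Module.finite_of_finite k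
  have := Fintype.ofFinite K
  simp only [FiniteField.coe_frobeniusAlgHom]
  rw [← pow_mul, ← sq, ← card_of_finrank_two hK, FiniteField.pow_card]

theorem algebraMap_trace_eq (hK : Module.finrank k K = 2) (z : K) :
    algebraMap k K (Algebra.trace k K z) = z + frob k K z := by
  have := finiteDimensional_of_finrank_two hK
  have : Finite K := Module.finite_of_finite k
  rw [FiniteField.algebraMap_trace_eq_sum_pow, hK]
  simp [Finset.sum_range_succ]

theorem algebraMap_norm_eq (hK : Module.finrank k K = 2) (z : K) :
    algebraMap k K (Algebra.norm k z) = z * frob k K z := by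
  have := finiteDimensional_of_finrank_two hK
  have : Finite K := Module.finite_of_finite k
  have := Fintype.ofFinite K
  rw [FiniteField.algebraMap_norm_eq_pow, Nat.card_eq_fintype_card, Nat.card_eq_fintype_card,
    card_of_finrank_two hK]
  have h1 : 1 < Fintype.card k := Fintype.one_lt_card
  have : (Fintype.card k ^ 2 - 1) / (Fintype.card k - 1) = Fintype.card k + 1 := by
    have h2 := Nat.sq_sub_sq (Fintype.card k) 1
    rw [one_pow] at h2
    rw [h2]
    exact Nat.mul_div_cancel _ (by omega)
  rw [this, pow_succ, mul_comm]
  rfl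

theorem trace_surjective (hK : Module.finrank k K = 2) :
    Function.Surjective (Algebra.trace k K) := by
  have := finiteDimensional_of_finrank_two hK
  have : Finite K := Module.finite_of_finite k
  exact Algebra.trace_surjective k K

theorem ncard_trace_eq [Fintype K] (hK : Module.finrank k K = 2) (t : k) :
    {z : K | Algebra.trace k K z = t}.ncard = Fintype.card k := by
  have := finiteDimensional_of_finrank_two hK
  obtain ⟨z₀, rfl⟩ := trace_surjective hK t
  have h1 := Submodule.card_eq_card_quotient_mul_card (LinearMap.ker (Algebra.trace k K))
  have h2 := Nat.card_congr ((Algebra.trace k K).quotKerEquivOfSurjective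
    (trace_surjective hK)).toEquiv
  have h3 : {z : K | Algebra.trace k K z = Algebra.trace k K z₀} =
      (fun z => z₀ + z) '' (LinearMap.ker (Algebra.trace k K) : Set K) := by
    ext z
    simp only [Set.mem_ofPred_eq, Set.mem_image, SetLike.mem_coe, LinearMap.mem_ker]
    exact ⟨fun h => ⟨z - z₀, by simp [h], by ring⟩, by rintro ⟨w, hw, rfl⟩; simp [hw]⟩
  rw [h3, Set.ncard_image_of_injective _ (add_right_injective z₀), ← Nat.card_coe_set_eq]
  rw [h2, Nat.card_eq_fintype_card (α := K), Nat.card_eq_fintype_card (α := k),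
    card_of_finrank_two hK, sq] at h1
  exact (Nat.eq_of_mul_eq_mul_right Fintype.card_pos h1).symm

theorem ncard_norm_eq [Fintype K] (hK : Module.finrank k K = 2) {t : k} (ht : t ≠ 0) :
    {z : K | Algebra.norm k z = t}.ncard = Fintype.card k + 1 := by
  have := finiteDimensional_of_finrank_two hK
  have hs := FiniteField.unitsMap_norm_surjective k K
  have h1 := Nat.card_congr (MonoidHom.fiberEquivKerOfSurjective hs (Units.mk0 t ht))
  have h2 := (Units.map (Algebra.norm k (S := K))).ker.card_eq_card_quotient_mul_card_subgroup
  have h3 := Nat.card_congr (QuotientGroup.quotientKerEquivOfSurjective _ hs).toEquiv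
  rw [h3, Nat.card_units, Nat.card_units, Nat.card_eq_fintype_card, Nat.card_eq_fintype_card,
    card_of_finrank_two hK] at h2
  have h4 : {z : K | Algebra.norm k z = t} = Units.val ''
      ((Units.map (Algebra.norm k (S := K))) ⁻¹' {Units.mk0 t ht}) := by
    ext z
    simp only [Set.mem_ofPred_eq, Set.mem_image, Set.mem_preimage, Set.mem_singleton_iff]
    constructor
    · intro h
      have hz : z ≠ 0 := by
        rintro rfl
        exact ht (by rw [← h, Algebra.norm_zero])
      exact ⟨Units.mk0 z hz, by ext; simpa using h, rfl⟩
    · rintro ⟨u, hu, rfl⟩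
      simpa using congrArg Units.val hu
  rw [h4, Set.ncard_image_of_injective _ Units.val_injective, ← Nat.card_coe_set_eq, h1]
  have hc : 1 < Fintype.card k := Fintype.one_lt_card
  have h5 : Fintype.card k ^ 2 - 1 = (Fintype.card k - 1) * (Fintype.card k + 1) := by
    rw [mul_comm, ← Nat.sq_sub_sq, one_pow]
  rw [h5] at h2
  exact (Nat.eq_of_mul_eq_mul_left (by omega) h2).symm

theorem exists_frob_ne (hK : Module.finrank k K = 2) : ∃ ω : K, frob k K ω ≠ ω := by
  by_contra! h
  have := finiteDimensional_of_finrank_two hK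
  have : Finite K := Module.finite_of_finite k
  have h1 := orderOf_eq_one_iff.mpr (AlgHom.ext h : frob k K = 1)
  rw [FiniteField.orderOf_frobeniusAlgHom, hK] at h1
  omega

theorem mem_range_of_frob_eq (hK : Module.finrank k K = 2) {z : K} (hz : frob k K z = z) :
    ∃ t : k, algebraMap k K t = z := by
  obtain ⟨ω, hω⟩ := exists_frob_ne hK
  have hω' : frob k K ω - ω ≠ 0 := sub_ne_zero.mpr hω
  by_contra! h
  -- otherwise `1, z` is a basis of `K` over `k`, and the Frobenius map fixes it
  have hli : LinearIndependent k ![(1 : K), z] := by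
    rw [LinearIndependent.pair_iff]
    intro s t hst
    have ht : t = 0 := by
      by_contra ht
      apply h (-(t⁻¹ * s))
      have : t • z = -(s • 1) := by rw [eq_neg_iff_add_eq_zero, add_comm]; exact hst
      have h2 : z = t⁻¹ • (t • z) := by rw [smul_smul, inv_mul_cancel₀ ht, one_smul]
      rw [h2, this, smul_neg, smul_smul, map_neg, Algebra.algebraMap_eq_smul_one]
    subst ht
    simpa using hst
  have htop : Submodule.span k (Set.range ![(1 : K), z]) = ⊤ :=
    hli.span_eq_top_of_card_eq_finrank (by simp [hK])
  have hmem : ω ∈ Submodule.span k (Set.range ![(1 : K), z]) := htop ▸ Submodule.mem_top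
  rw [Matrix.range_cons, Matrix.range_cons, Matrix.range_empty, Set.union_empty,
    Set.singleton_union, Submodule.mem_span_pair] at hmem
  obtain ⟨s, t, rfl⟩ := hmem
  exact hω (by rw [map_add, map_smul, map_smul, map_one, hz])

end Quadratic

/-! ### Hyperplane sections of a Hermitian variety -/

theorem ncard_ker_mul_card {F W : Type*} [Field F] [Fintype F] [AddCommGroup W] [Module F W]
    [Fintype W] {φ : W →ₗ[F] F} (hφ : φ ≠ 0) :
    {x | φ x = 0}.ncard * Fintype.card F = Fintype.card W := by
  have h1 := Submodule.card_eq_card_quotient_mul_card (LinearMap.ker φ)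
  rw [Nat.card_congr (φ.quotKerEquivOfSurjective (LinearMap.surjective hφ)).toEquiv,
    Nat.card_eq_fintype_card (α := W), Nat.card_eq_fintype_card (α := F)] at h1
  rw [h1]
  rfl

section SkewHermitian

variable (k : Type*) {K W : Type*} [Field k] [Fintype k] [Field K] [Algebra k K]
  [AddCommGroup W] [Module K W]

/-- A skew-Hermitian form on a vector space over the quadratic extension `K` of `k`, linear in the
first variable. -/
structure IsSkewHermitian (h : W → W → K) : Prop where
  add_left : ∀ x y z, h (x + y) z = h x z + h y z
  smul_left : ∀ (c : K) x y, h (c • x) y = c * h x y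
  skew : ∀ x y, h y x = -frob k K (h x y)

variable {k} {h : W → W → K}

namespace IsSkewHermitian

theorem add_right (H : IsSkewHermitian k h) (x y z : W) : h x (y + z) = h x y + h x z := by
  rw [H.skew, H.add_left, map_add, neg_add, ← H.skew, ← H.skew]

theorem smul_right (H : IsSkewHermitian k h) (c : K) (x y : W) :
    h x (c • y) = frob k K c * h x y := by
  rw [H.skew, H.smul_left, map_mul, ← mul_neg, ← H.skew]

theorem frob_self (H : IsSkewHermitian k h) (x : W) : frob k K (h x x) = -h x x := by
  conv_rhs => rw [H.skew x x, neg_neg]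

theorem eq_zero_comm (H : IsSkewHermitian k h) {x y : W} : h x y = 0 ↔ h y x = 0 := by
  rw [H.skew x y, neg_eq_zero, map_eq_zero]

theorem zero_left (H : IsSkewHermitian k h) (y : W) : h 0 y = 0 := by
  simpa using H.smul_left 0 0 y

theorem zero_right (H : IsSkewHermitian k h) (y : W) : h y 0 = 0 :=
  H.eq_zero_comm.mp (H.zero_left y)

/-- The functional `x ↦ h x y`. -/
def toDual (H : IsSkewHermitian k h) (y : W) : W →ₗ[K] K where
  toFun x := h x y
  map_add' x z := H.add_left x z y
  map_smul' c x := H.smul_left c x y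

theorem ncard_polar_mul_card (H : IsSkewHermitian k h) [Fintype K] [Fintype W] {y : W}
    (hy : ∃ x, h y x ≠ 0) : {x | h y x = 0}.ncard * Fintype.card K = Fintype.card W := by
  obtain ⟨x, hx⟩ := hy
  rw [← ncard_ker_mul_card (φ := H.toDual y)]
  · congr 2
    ext x
    exact H.eq_zero_comm
  · intro h0
    exact hx (H.eq_zero_comm.mp (LinearMap.congr_fun h0 x))

theorem self_add_smul (H : IsSkewHermitian k h) (x y : W) (c : K) :
    h (x + c • y) (x + c • y) =
      h x x + (c * h y x - frob k K (c * h y x)) + c * frob k K c * h y y := by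
  rw [H.add_left, H.add_right, H.add_right, H.smul_left, H.smul_left, H.smul_right, H.smul_right,
    H.skew y x, map_mul]
  ring

/-- A line through an isotropic point `y`, not in the polar hyperplane of `y`, has `q` isotropic
points other than `y`. -/
theorem ncard_isotropic_line (H : IsSkewHermitian k h) (hK : Module.finrank k K = 2) [Fintype K]
    {x y : W} (hy : h y y = 0) (hxy : h y x ≠ 0) :
    {c : K | h (x + c • y) (x + c • y) = 0}.ncard = Fintype.card k := by
  obtain ⟨ω, hω⟩ := exists_frob_ne hK
  -- multiplication by `ε` turns the skew-Hermitian form into a Hermitian one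
  set ε := ω - frob k K ω with hε
  have hε0 : ε ≠ 0 := sub_ne_zero.mpr hω.symm
  have hεf : frob k K ε = -ε := by rw [hε, map_sub, frob_frob hK]; ring
  obtain ⟨s, hs⟩ := mem_range_of_frob_eq hK (z := ε * h x x)
    (by rw [map_mul, hεf, H.frob_self]; ring)
  have hset : {c : K | h (x + c • y) (x + c • y) = 0} =
      (fun z => (ε * h y x)⁻¹ * z) '' {z : K | Algebra.trace k K z = -s} := by
    have hne : ε * h y x ≠ 0 := mul_ne_zero hε0 hxy
    have key : ∀ c : K, h (x + c • y) (x + c • y) = 0 ↔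
        Algebra.trace k K (ε * h y x * c) = -s := by
      intro c
      rw [← (algebraMap k K).injective.eq_iff, algebraMap_trace_eq hK, map_neg, hs,
        H.self_add_smul, hy, ← mul_right_inj' hε0, map_mul, map_mul, map_mul, hεf,
        ← sub_eq_zero (a := _ + _) (b := -(ε * h x x))]
      ring_nf
    ext c
    simp only [Set.mem_image, Set.mem_ofPred_eq, key]
    constructor
    · intro hc
      exact ⟨_, hc, by field_simp⟩
    · rintro ⟨z, hz, rfl⟩
      rwa [mul_inv_cancel_left₀ hne]
  rw [hset, Set.ncard_image_of_injective _ (mul_right_injective₀ (inv_ne_zero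
    (mul_ne_zero hε0 hxy))), ncard_trace_eq hK]

/-- The number of isotropic vectors in the polar hyperplane of an isotropic vector. -/
theorem ncard_tangent_section (H : IsSkewHermitian k h) (hK : Module.finrank k K = 2) [Fintype W]
    {y : W} (hy : h y y = 0) (hy' : ∃ x, h y x ≠ 0) {m : ℤ}
    (hm : (Fintype.card W : ℤ) = (Fintype.card k : ℤ) ^ 2 * m) :
    (Fintype.card k : ℤ) * {x | h y x = 0 ∧ h x x = 0}.ncard =
      Fintype.card k * {x | h x x = 0}.ncard - m * ((Fintype.card k : ℤ) ^ 2 - 1) := by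
  classical
  have := finiteDimensional_of_finrank_two hK
  have : Finite K := Module.finite_of_finite k
  have := Fintype.ofFinite K
  have hcK := card_of_finrank_two hK
  have hq : (Fintype.card k : ℤ) ≠ 0 := by exact_mod_cast Fintype.card_ne_zero
  -- the pairs `(c, x)` with `x + c y` isotropic: each translation by `c y` permutes the vectors,
  -- while for fixed `x` one counts the isotropic vectors on a line through `y`
  have h1 := sum_ncard_comm (fun (c : K) (x : W) => h (x + c • y) (x + c • y) = 0)
  have hL : ∀ c : K, {x : W | h (x + c • y) (x + c • y) = 0}.ncard = {x | h x x = 0}.ncard := by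
    intro c
    rw [← Set.ncard_image_of_injective _ (add_left_injective (c • y))]
    congr 1
    ext x
    simp only [Set.mem_image, Set.mem_ofPred_eq]
    exact ⟨by rintro ⟨z, hz, rfl⟩; exact hz, fun hx => ⟨x - c • y, by simpa using hx, by simp⟩⟩
  have hR : ∀ x : W, ({c : K | h (x + c • y) (x + c • y) = 0}.ncard : ℤ) =
      (if h y x = 0 ∧ h x x = 0 then (Fintype.card k : ℤ) ^ 2 else 0) +
      (if h y x = 0 then 0 else (Fintype.card k : ℤ)) := by
    intro x
    by_cases hyx : h y x = 0
    · have : ∀ c : K, h (x + c • y) (x + c • y) = h x x := by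
        intro c
        rw [H.self_add_smul, hy, hyx]
        simp
      simp only [this, hyx, true_and, if_true, add_zero]
      split_ifs with hx
      · simp [hx, Set.ncard_univ, hcK]
      · simp [hx]
    · rw [H.ncard_isotropic_line hK hy hyx]
      simp [hyx]
  simp_rw [hL, hR] at h1
  rw [Finset.sum_add_distrib, sum_ite_const, sum_ite_const, Finset.sum_const, Finset.card_univ,
    nsmul_eq_mul, hcK, hm] at h1
  have h2 := H.ncard_polar_mul_card hy'
  rw [hcK] at h2
  have h3 : ({x | h y x = 0}.ncard : ℤ) = m := by
    have : ({x | h y x = 0}.ncard : ℤ) * (Fintype.card k : ℤ) ^ 2 = Fintype.card W := by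
      exact_mod_cast h2
    rw [hm, mul_comm] at this
    exact mul_left_cancel₀ (pow_ne_zero 2 hq) this
  rw [h3] at h1
  push_cast at h1
  apply mul_left_cancel₀ hq
  linear_combination -h1

/-- The number of isotropic vectors in the polar hyperplane of a non-isotropic vector. -/
theorem ncard_nontangent_section (H : IsSkewHermitian k h) (hK : Module.finrank k K = 2)
    [Fintype W] {y : W} (hy : h y y ≠ 0) {m : ℤ}
    (hm : (Fintype.card W : ℤ) = (Fintype.card k : ℤ) ^ 2 * m) :
    (Fintype.card k : ℤ) * {x | h y x = 0 ∧ h x x = 0}.ncard =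
      (Fintype.card k + 1) * m - {x | h x x = 0}.ncard := by
  classical
  have := finiteDimensional_of_finrank_two hK
  have : Finite K := Module.finite_of_finite k
  have := Fintype.ofFinite K
  have hcK := card_of_finrank_two hK
  have hq : (Fintype.card k : ℤ) ≠ 0 := by exact_mod_cast Fintype.card_ne_zero
  have h2 := H.ncard_polar_mul_card ⟨y, hy⟩
  rw [hcK] at h2
  have h3 : ({x | h y x = 0}.ncard : ℤ) = m := by
    have : ({x | h y x = 0}.ncard : ℤ) * (Fintype.card k : ℤ) ^ 2 = Fintype.card W := by
      exact_mod_cast h2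
    rw [hm, mul_comm] at this
    exact mul_left_cancel₀ (pow_ne_zero 2 hq) this
  -- the isotropic vectors `x`, sorted by the coefficient `c` of their projection `c y` to `K y`
  have h1 := sum_ncard_comm (fun (c : K) (x : W) => h x y = c * h y y ∧ h x x = 0)
  have hR : ∀ x : W, ({c : K | h x y = c * h y y ∧ h x x = 0}.ncard : ℤ) =
      if h x x = 0 then 1 else 0 := by
    intro x
    split_ifs with hx
    · have : {c : K | h x y = c * h y y ∧ h x x = 0} = {h x y / h y y} := by
        ext c
        simp only [Set.mem_ofPred_eq, Set.mem_singleton_iff, hx, and_true, eq_div_iff hy]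
        exact eq_comm
      rw [this, Set.ncard_singleton, Nat.cast_one]
    · simp [hx]
  have hL : ∀ c : K, {x : W | h x y = c * h y y ∧ h x x = 0}.ncard =
      {x | h y x = 0 ∧ h (x + c • y) (x + c • y) = 0}.ncard := by
    intro c
    rw [← Set.ncard_image_of_injective {x | h y x = 0 ∧ _} (add_left_injective (c • y))]
    congr 1
    ext x
    simp only [Set.mem_image, Set.mem_ofPred_eq]
    constructor
    · rintro ⟨h4, h5⟩
      refine ⟨x - c • y, ⟨?_, by simpa using h5⟩, by simp⟩
      rw [H.eq_zero_comm, sub_eq_add_neg, ← neg_smul, H.add_left, H.smul_left, h4]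
      ring
    · rintro ⟨z, ⟨hz, hz'⟩, rfl⟩
      refine ⟨?_, hz'⟩
      rw [H.add_left, H.smul_left, H.eq_zero_comm.mp hz, zero_add]
  simp_rw [hR, hL] at h1
  rw [sum_ncard_comm, sum_ite_const] at h1
  have hN : ∀ x : W, ({c : K | h y x = 0 ∧ h (x + c • y) (x + c • y) = 0}.ncard : ℤ) =
      (if h y x = 0 ∧ h x x = 0 then -(Fintype.card k : ℤ) else 0) +
      (if h y x = 0 then (Fintype.card k : ℤ) + 1 else 0) := by
    intro x
    by_cases hyx : h y x = 0
    swap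
    · simp [hyx]
    have hval : ∀ c : K, h (x + c • y) (x + c • y) = h x x + c * frob k K c * h y y := by
      intro c
      rw [H.self_add_smul, hyx]
      simp
    simp only [hyx, true_and, if_true, hval, ← algebraMap_norm_eq hK]
    obtain ⟨t, ht⟩ := mem_range_of_frob_eq hK (z := -h x x / h y y) (by
      rw [map_div₀, map_neg, H.frob_self, H.frob_self, neg_div_neg_eq])
    have hnorm : ∀ c : K, h x x + algebraMap k K (Algebra.norm k c) * h y y = 0 ↔
        Algebra.norm k c = t := by
      intro c
      rw [← (algebraMap k K).injective.eq_iff, ht, eq_div_iff hy, eq_neg_iff_add_eq_zero, add_comm]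
    simp only [hnorm]
    split_ifs with hx
    · have ht0 : t = 0 := by
        rw [← map_eq_zero (algebraMap k K), ht, hx]
        simp
      have : {c : K | Algebra.norm k c = t} = {0} := by
        ext c
        simp [ht0, Algebra.norm_eq_zero_iff]
      rw [this]
      simp
    · have ht0 : t ≠ 0 := by
        rintro rfl
        rw [map_zero, eq_comm, div_eq_zero_iff, neg_eq_zero] at ht
        tauto
      rw [ncard_norm_eq hK ht0]
      push_cast
      ring
  simp_rw [hN] at h1
  rw [Finset.sum_add_distrib, sum_ite_const, sum_ite_const, h3] at h1
  linear_combination -h1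

end IsSkewHermitian
end SkewHermitian

/-! ### Coordinates on `K ⊗ V` -/

section Coordinates

variable {k K V : Type*} [Field k] [Fintype k] [Field K] [Algebra k K]
  [AddCommGroup V] [Module k V]

/-- The vector `1 ⊗ u + ω ⊗ v`. If `ω` is not in `k`, every vector of `K ⊗ V` is uniquely of this
form; if moreover `u, v` are independent over `k`, then this vector spans a point outside `PG(V)`
and the unique line of `PG(V)` whose extension contains this point is spanned by `u` and `v`. -/
noncomputable def tensorPair (ω : K) (u v : V) : K ⊗[k] V := (1 : K) ⊗ₜ[k] u + ω ⊗ₜ[k] v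

theorem linearIndependent_one_of_frob_ne {ω : K} (hω : frob k K ω ≠ ω) :
    LinearIndependent k ![(1 : K), ω] := by
  rw [LinearIndependent.pair_iff]
  intro s t hst
  have h1 := congrArg (frob k K) hst
  rw [map_add, map_smul, map_smul, map_one, map_zero, ← hst, add_right_inj, ← sub_eq_zero,
    ← smul_sub, smul_eq_zero, or_iff_left (sub_ne_zero.mpr hω)] at h1
  subst h1
  simpa using hst

theorem tensorPair_bijective (hK : Module.finrank k K = 2) {ω : K} (hω : frob k K ω ≠ ω) :
    Function.Bijective fun p : V × V => (tensorPair ω p.1 p.2 : K ⊗[k] V) := by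
  let b := basisOfLinearIndependentOfCardEqFinrank (linearIndependent_one_of_frob_ne hω)
    (by simp [hK])
  have hb0 : b.repr (1 : K) = Finsupp.single 0 1 := by
    rw [← b.repr_self 0]
    simp [b]
  have hb1 : b.repr ω = Finsupp.single 1 1 := by
    rw [← b.repr_self 1]
    simp [b]
  let E := TensorProduct.equivFinsuppOfBasisLeft (N := V) b
  have hE0 : ∀ u v : V, E (tensorPair ω u v) 0 = u := by
    intro u v
    simp [E, tensorPair, hb0, hb1]
  have hE1 : ∀ u v : V, E (tensorPair ω u v) 1 = v := by
    intro u v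
    simp [E, tensorPair, hb0, hb1]
  constructor
  · rintro ⟨u, v⟩ ⟨u', v'⟩ h
    have h' : (tensorPair ω u v : K ⊗[k] V) = tensorPair ω u' v' := h
    refine Prod.ext ?_ ?_
    · rw [← hE0 u v, h', hE0]
    · rw [← hE1 u v, h', hE1]
  · intro x
    refine ⟨(E x 0, E x 1), E.injective ?_⟩
    ext i
    fin_cases i
    · exact hE0 _ _
    · exact hE1 _ _

theorem exists_eq_tensorPair (hK : Module.finrank k K = 2) {ω : K} (hω : frob k K ω ≠ ω)
    (x : K ⊗[k] V) : ∃ u v : V, x = tensorPair ω u v := by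
  obtain ⟨⟨u, v⟩, h⟩ := (tensorPair_bijective hK hω).2 x
  exact ⟨u, v, h.symm⟩

theorem tensorPair_inj (hK : Module.finrank k K = 2) {ω : K} (hω : frob k K ω ≠ ω)
    {u v u' v' : V} : (tensorPair ω u v : K ⊗[k] V) = tensorPair ω u' v' ↔ u = u' ∧ v = v' := by
  rw [← Prod.mk.injEq]
  exact (tensorPair_bijective hK hω).1.eq_iff (a := (u, v)) (b := (u', v'))

omit [Fintype k] in
theorem tensorPair_zero {ω : K} : (tensorPair ω 0 0 : K ⊗[k] V) = 0 := by
  simp [tensorPair]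

theorem tensorPair_mem_baseChange (hK : Module.finrank k K = 2) {ω : K} (hω : frob k K ω ≠ ω)
    {u v : V} {l : Submodule k V} :
    (tensorPair ω u v : K ⊗[k] V) ∈ l.baseChange K ↔ u ∈ l ∧ v ∈ l := by
  constructor
  · intro h
    obtain ⟨y, hy⟩ := h
    obtain ⟨u', v', rfl⟩ := exists_eq_tensorPair hK hω y
    have : l.subtype.baseChange K (tensorPair ω u' v') = tensorPair ω (u' : V) (v' : V) := by
      simp [tensorPair]
    rw [this] at hy
    obtain ⟨rfl, rfl⟩ := (tensorPair_inj hK hω).mp hy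
    exact ⟨u'.2, v'.2⟩
  · rintro ⟨hu, hv⟩
    exact add_mem (Submodule.tmul_mem_baseChange_of_mem _ hu)
      (Submodule.tmul_mem_baseChange_of_mem _ hv)

/-- The sesquilinear form `(x, y) ↦ f(x, τ y)` on `K ⊗ V` attached to a form `f` on `V`. -/
noncomputable def tensorForm (K : Type*) [Field K] [Algebra k K] (f : LinearMap.BilinForm k V) :
    K ⊗[k] V → K ⊗[k] V → K :=
  fun x y => f.baseChange K x (tau k K V y)

variable (f : LinearMap.BilinForm k V)

theorem tensorForm_tmul (a b : K) (u v : V) :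
    tensorForm K f (a ⊗ₜ u) (b ⊗ₜ v) = a * frob k K b * algebraMap k K (f u v) := by
  simp [tensorForm, tau, Algebra.smul_def]
  ring

theorem tensorForm_add_left (x y z : K ⊗[k] V) :
    tensorForm K f (x + y) z = tensorForm K f x z + tensorForm K f y z := by
  simp [tensorForm]

theorem tensorForm_add_right (x y z : K ⊗[k] V) :
    tensorForm K f x (y + z) = tensorForm K f x y + tensorForm K f x z := by
  simp [tensorForm]

theorem tensorForm_tensorPair_tmul (ω c : K) (u v w : V) :
    tensorForm K f (tensorPair ω u v) (c ⊗ₜ w) =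
      frob k K c * (algebraMap k K (f u w) + ω * algebraMap k K (f v w)) := by
  rw [tensorPair, tensorForm_add_left, tensorForm_tmul, tensorForm_tmul]
  ring

theorem tensorForm_tensorPair (ω : K) (u v u' v' : V) :
    tensorForm K f (tensorPair ω u v) (tensorPair ω u' v') =
      algebraMap k K (f u u') + ω * algebraMap k K (f v u') +
        frob k K ω * (algebraMap k K (f u v') + ω * algebraMap k K (f v v')) := by
  rw [tensorPair.eq_def ω u' v', tensorForm_add_right, tensorForm_tensorPair_tmul,
    tensorForm_tensorPair_tmul, map_one, one_mul]

variable {f}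

theorem isSkewHermitian_tensorForm (hK : Module.finrank k K = 2) (hf : f.IsAlt) :
    IsSkewHermitian k (tensorForm K f) where
  add_left := tensorForm_add_left f
  smul_left c x y := by simp [tensorForm]
  skew x y := by
    induction x with
    | zero => simp [tensorForm]
    | add x x' hx hx' => rw [tensorForm_add_left, tensorForm_add_right, hx, hx', map_add, neg_add]
    | tmul a u =>
      induction y with
      | zero => simp [tensorForm]
      | add y y' hy hy' => rw [tensorForm_add_left, tensorForm_add_right, hy, hy', map_add, neg_add]
      | tmul b v =>
        rw [tensorForm_tmul, tensorForm_tmul, map_mul, map_mul, frob_frob hK, AlgHom.commutes,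
          ← hf.neg_eq u v, map_neg]
        ring

theorem tensorForm_self (hf : f.IsAlt) (ω : K) (u v : V) :
    tensorForm K f (tensorPair ω u v) (tensorPair ω u v) =
      (frob k K ω - ω) * algebraMap k K (f u v) := by
  rw [tensorForm_tensorPair, hf u, hf v, ← hf.neg_eq u v, map_zero, map_neg]
  ring

/-- A point of `PG(K ⊗ V)` is isotropic if and only if the line of `PG(V)` whose extension contains
this point is totally isotropic. -/
theorem tensorForm_self_eq_zero (hf : f.IsAlt) {ω : K} (hω : frob k K ω ≠ ω) {u v : V} :
    tensorForm K f (tensorPair ω u v) (tensorPair ω u v) = 0 ↔ f u v = 0 := by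
  rw [tensorForm_self hf, mul_eq_zero, or_iff_right (sub_ne_zero.mpr hω), map_eq_zero]

theorem add_mul_eq_zero_iff {ω : K} (hω : frob k K ω ≠ ω) {s t : k} :
    algebraMap k K s + ω * algebraMap k K t = 0 ↔ s = 0 ∧ t = 0 := by
  constructor
  · intro h
    have h1 := linearIndependent_one_of_frob_ne hω
    rw [LinearIndependent.pair_iff] at h1
    apply h1 s t
    rw [Algebra.smul_def, Algebra.smul_def, mul_one, mul_comm _ ω, h]
  · rintro ⟨rfl, rfl⟩
    simp

theorem tensorForm_tensorPair_one_tmul_eq_zero {ω : K} (hω : frob k K ω ≠ ω) {u v w : V} :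
    tensorForm K f (tensorPair ω u v) (1 ⊗ₜ w) = 0 ↔ f u w = 0 ∧ f v w = 0 := by
  rw [tensorForm_tensorPair_tmul, map_one, one_mul, add_mul_eq_zero_iff hω]

theorem exists_tensorForm_ne_zero (hK : Module.finrank k K = 2) (hf : f.Nondegenerate)
    {x : K ⊗[k] V} (hx : x ≠ 0) : ∃ y, tensorForm K f x y ≠ 0 := by
  obtain ⟨ω, hω⟩ := exists_frob_ne hK
  obtain ⟨u, v, rfl⟩ := exists_eq_tensorPair hK hω x
  by_contra! h
  apply hx
  have h1 : ∀ w, f u w = 0 ∧ f v w = 0 := fun w =>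
    (tensorForm_tensorPair_one_tmul_eq_zero hω).mp (h (1 ⊗ₜ w))
  rw [hf.1 u fun w => (h1 w).1, hf.1 v fun w => (h1 w).2, tensorPair_zero]

end Coordinates

/-! ### The forms of the pencil -/

section PencilForms

variable {k K V : Type*} [Field k] [Fintype k] [Field K] [Algebra k K]
  [AddCommGroup V] [Module K V] [Module k V] [IsScalarTower k K V]
  {B : LinearMap.BilinForm K V}

omit [Fintype k] in
theorem pencilForm_apply (a : K) (x y : V) :
    pencilForm k B a x y = Algebra.trace k K (a * B x y) := rfl

theorem hermitianForm_eq (a : K) : hermitianForm k B a = tensorForm K (pencilForm k B a) := rfl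

omit [Fintype k] in
theorem pencilForm_isAlt (hB : B.IsAlt) (a : K) : (pencilForm k B a).IsAlt := fun x => by
  rw [pencilForm_apply, hB x, mul_zero, map_zero]

theorem eq_zero_of_forall_trace_mul (hK : Module.finrank k K = 2) {z : K}
    (h : ∀ c : K, Algebra.trace k K (c * z) = 0) : z = 0 := by
  by_contra hz
  obtain ⟨t, ht⟩ := trace_surjective hK (1 : k)
  have := h (t * z⁻¹)
  rw [inv_mul_cancel_right₀ hz, ht] at this
  exact one_ne_zero this

theorem forall_pencilForm_smul_eq_zero (hK : Module.finrank k K = 2) {a : K} (ha : a ≠ 0)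
    {u w : V} : (∀ c : K, pencilForm k B a u (c • w) = 0) ↔ B u w = 0 := by
  constructor
  · intro h
    refine eq_zero_of_forall_trace_mul (k := k) hK fun c => ?_
    have := h (c * a⁻¹)
    rwa [pencilForm_apply, map_smul, smul_eq_mul, ← mul_assoc, mul_comm c, mul_inv_cancel_left₀ ha]
      at this
  · intro h c
    rw [pencilForm_apply, map_smul, h, smul_zero, mul_zero, map_zero]

theorem pencilForm_nondegenerate (hK : Module.finrank k K = 2) (hB : B.IsAlt)
    (hBnd : B.Nondegenerate) {a : K} (ha : a ≠ 0) : (pencilForm k B a).Nondegenerate := by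
  have hl : ∀ x, (∀ y, pencilForm k B a x y = 0) → x = 0 := fun x hx =>
    hBnd.1 x fun y => (forall_pencilForm_smul_eq_zero hK ha).mp fun c => hx _
  refine ⟨hl, fun y hy => hl y fun x => ?_⟩
  rw [← (pencilForm_isAlt hB a).neg_eq, neg_eq_zero]
  exact hy x

/-- The polar hyperplane of `1 ⊗ u + ω ⊗ v` for one member of the pencil is the polar hyperplane of
`1 ⊗ (b/c) u + ω ⊗ (b/c) v` for another. -/
theorem hermitianForm_eq_hermitianForm_smul {b c : K} (hc : c ≠ 0) (hK : Module.finrank k K = 2)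
    {ω : K} (hω : frob k K ω ≠ ω) (u v : V) (x : K ⊗[k] V) :
    hermitianForm k B b (tensorPair ω u v) x =
      hermitianForm k B c (tensorPair ω ((b / c) • u) ((b / c) • v)) x := by
  obtain ⟨u', v', rfl⟩ := exists_eq_tensorPair hK hω x
  have h : ∀ y z : V, pencilForm k B c ((b / c) • y) z = pencilForm k B b y z := by
    intro y z
    rw [pencilForm_apply, pencilForm_apply, map_smul, LinearMap.smul_apply, smul_eq_mul,
      ← mul_assoc, mul_div_cancel₀ b hc]
  simp only [hermitianForm_eq, tensorForm_tensorPair, h]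

end PencilForms

/-! ### Vectors on extended lines of a spread -/

section Orthogonal

variable {F V : Type*} [Field F] [Fintype F] [AddCommGroup V] [Module F V] [Fintype V]
  {B : LinearMap.BilinForm F V}

omit [Fintype F] [Fintype V] in
theorem exists_mem_span_of_not_linearIndependent {u v : V} (h : ¬ LinearIndependent F ![u, v]) :
    ∃ w, u ∈ Submodule.span F {w} ∧ v ∈ Submodule.span F {w} := by
  rw [LinearIndependent.pair_iff] at h
  push Not at h
  obtain ⟨s, t, hst, h⟩ := h
  simp only [Submodule.mem_span_singleton]
  by_cases hs : s = 0
  · subst hs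
    rw [zero_smul, zero_add, smul_eq_zero, or_iff_right (h rfl)] at hst
    exact ⟨u, ⟨1, one_smul _ _⟩, 0, by rw [hst, zero_smul]⟩
  · refine ⟨v, ⟨-(s⁻¹ * t), ?_⟩, 1, one_smul _ _⟩
    rw [neg_smul, mul_smul, ← smul_neg, ← eq_neg_of_add_eq_zero_left hst, inv_smul_smul₀ hs]

omit [Fintype F] [Fintype V] in
theorem not_linearIndependent_of_mem_span {u v w : V} (hu : u ∈ Submodule.span F {w})
    (hv : v ∈ Submodule.span F {w}) : ¬ LinearIndependent F ![u, v] := by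
  obtain ⟨a, rfl⟩ := Submodule.mem_span_singleton.mp hu
  obtain ⟨b, rfl⟩ := Submodule.mem_span_singleton.mp hv
  rw [LinearIndependent.pair_iff]
  intro h
  have h1 := h b (-a) (by rw [smul_smul, smul_smul, ← add_smul]; ring_nf; exact zero_smul _ _)
  have h2 := h 1 0 (by rw [neg_eq_zero.mp h1.2, zero_smul, smul_zero, zero_smul, add_zero])
  exact one_ne_zero h2.1

theorem ncard_orthogonal_pair_of_linearIndependent (hB : B.Nondegenerate) {u v : V}
    (h : LinearIndependent F ![u, v]) :
    {x | B u x = 0 ∧ B v x = 0}.ncard * Fintype.card F ^ 2 = Fintype.card V := by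
  have h1 : {x | B u x = 0 ∧ B v x = 0} =
      (B.orthogonal (Submodule.span F (Set.range ![u, v])) : Set V) := by
    ext x
    simp only [Set.mem_ofPred_eq, SetLike.mem_coe, LinearMap.BilinForm.mem_orthogonal_iff]
    rw [Matrix.range_cons, Matrix.range_cons, Matrix.range_empty, Set.union_empty,
      Set.singleton_union]
    simp only [Submodule.mem_span_pair]
    constructor
    · rintro ⟨hu, hv⟩ _ ⟨a, b, rfl⟩
      simp [hu, hv]
    · intro hx
      exact ⟨hx u ⟨1, 0, by simp⟩, hx v ⟨0, 1, by simp⟩⟩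
  have h2 := LinearMap.BilinForm.finrank_orthogonal hB (Submodule.span F (Set.range ![u, v]))
  have h3 := Submodule.finrank_le (Submodule.span F (Set.range ![u, v]))
  rw [finrank_span_eq_card h, Fintype.card_fin] at h2 h3
  rw [h1, ← Nat.card_coe_set_eq, Module.card_eq_pow_finrank (K := F) (V := V)]
  have h4 := Module.natCard_eq_pow_finrank (K := F)
    (V := B.orthogonal (Submodule.span F (Set.range ![u, v])))
  rw [h2, Nat.card_eq_fintype_card (α := F)] at h4
  change Nat.card (B.orthogonal (Submodule.span F (Set.range ![u, v]))) * _ = _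
  rw [h4, ← pow_add, Nat.sub_add_cancel h3]

theorem ncard_orthogonal_pair_of_not_linearIndependent (hB : B.Nondegenerate) {u v : V}
    (h : ¬ LinearIndependent F ![u, v]) (huv : ¬ (u = 0 ∧ v = 0)) :
    {x | B u x = 0 ∧ B v x = 0}.ncard * Fintype.card F = Fintype.card V := by
  obtain ⟨w, hu, hv⟩ := exists_mem_span_of_not_linearIndependent h
  obtain ⟨a, rfl⟩ := Submodule.mem_span_singleton.mp hu
  obtain ⟨b, rfl⟩ := Submodule.mem_span_singleton.mp hv
  have hw : w ≠ 0 := by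
    rintro rfl
    simp at huv
  rw [← ncard_ker_mul_card (φ := B w)]
  · congr 2
    ext x
    simp only [map_smul, LinearMap.smul_apply, smul_eq_mul, mul_eq_zero, Set.mem_ofPred_eq]
    have : ¬ (a = 0 ∧ b = 0) := by
      rintro ⟨rfl, rfl⟩
      simp at huv
    tauto
  · intro h0
    exact hw (hB.1 w fun y => LinearMap.congr_fun h0 y)

end Orthogonal

section SpreadCone

variable {k K V : Type*} (F : Type*) [Field k] [Fintype k] [Field K] [Algebra k K]
  [AddCommGroup V] [Module k V] [Field F] [Algebra k F] [Module F V] [IsScalarTower k F V]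

variable (k K V) in
/-- The set of vectors of `K ⊗ V` lying on the extensions of the one-dimensional `F`-subspaces of
`V`, for an extension `F` of `k`. For `F = k` these are the vectors on points of `PG(V)`, and for
`F = K` the vectors on the extended lines of Dye's spread. -/
def spreadCone : Set (K ⊗[k] V) :=
  {x | ∃ w : V, x ∈ ((Submodule.span F {w}).restrictScalars k).baseChange K}

theorem tensorPair_mem_spreadCone (hK : Module.finrank k K = 2) {ω : K} (hω : frob k K ω ≠ ω)
    {u v : V} : tensorPair ω u v ∈ spreadCone k K V F ↔ ¬ LinearIndependent F ![u, v] := by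
  simp only [spreadCone, Set.mem_ofPred_eq, tensorPair_mem_baseChange hK hω,
    Submodule.restrictScalars_mem]
  constructor
  · rintro ⟨w, hu, hv⟩
    exact not_linearIndependent_of_mem_span hu hv
  · exact exists_mem_span_of_not_linearIndependent

variable {F}

/-- A nonzero vector of the cone lies on the extension of exactly one `F`-line, which has
`|F| - 1` generators. -/
theorem ncard_generators [Fintype F] (hK : Module.finrank k K = 2) {x : K ⊗[k] V} (hx : x ≠ 0)
    (hx' : x ∈ spreadCone k K V F) :
    {w : V | w ≠ 0 ∧ x ∈ ((Submodule.span F {w}).restrictScalars k).baseChange K}.ncard =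
      Fintype.card F - 1 := by
  obtain ⟨ω, hω⟩ := exists_frob_ne hK
  obtain ⟨u, v, rfl⟩ := exists_eq_tensorPair hK hω x
  obtain ⟨w₀, hw₀⟩ := hx'
  simp only [tensorPair_mem_baseChange hK hω, Submodule.restrictScalars_mem] at hw₀ ⊢
  have hw0 : w₀ ≠ 0 := by
    rintro rfl
    simp only [Submodule.span_zero_singleton, Submodule.mem_bot] at hw₀
    exact hx (by rw [hw₀.1, hw₀.2, tensorPair_zero])
  have huv : ∃ z, z ≠ 0 ∧ (z = u ∨ z = v) := by
    by_contra! h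
    refine hx ?_
    rw [not_not.mp fun hu => (h u hu).1 rfl, not_not.mp fun hv => (h v hv).2 rfl, tensorPair_zero]
  obtain ⟨z, hz, hzuv⟩ := huv
  have hspan : ∀ w : V, z ∈ Submodule.span F {w} → Submodule.span F {z} = Submodule.span F {w} := by
    intro w hw
    obtain ⟨c, rfl⟩ := Submodule.mem_span_singleton.mp hw
    have hc : c ≠ 0 := by
      rintro rfl
      exact hz (zero_smul _ _)
    exact Submodule.span_singleton_smul_eq (IsUnit.mk0 c hc) w
  have hmem : ∀ w : V, u ∈ Submodule.span F {w} → v ∈ Submodule.span F {w} →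
      z ∈ Submodule.span F {w} := by
    intro w hu hv
    rcases hzuv with h | h <;> rw [h] <;> assumption
  have hset : {w : V | w ≠ 0 ∧ u ∈ Submodule.span F {w} ∧ v ∈ Submodule.span F {w}} =
      (fun c : F => c • w₀) '' {c : F | c ≠ 0} := by
    ext w
    simp only [Set.mem_ofPred_eq, Set.mem_image]
    constructor
    · rintro ⟨hw, huw, hvw⟩
      have h1 : Submodule.span F {w} = Submodule.span F {w₀} :=
        (hspan w (hmem w huw hvw)).symm.trans (hspan w₀ (hmem w₀ hw₀.1 hw₀.2))
      have h2 : w ∈ Submodule.span F {w₀} := by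
        rw [← h1]
        exact Submodule.mem_span_singleton_self w
      obtain ⟨c, rfl⟩ := Submodule.mem_span_singleton.mp h2
      exact ⟨c, fun hc => hw (by rw [hc, zero_smul]), rfl⟩
    · rintro ⟨c, hc, rfl⟩
      have h1 := Submodule.span_singleton_smul_eq (IsUnit.mk0 c hc) w₀
      simp only [h1]
      exact ⟨smul_ne_zero hc hw0, hw₀⟩
  rw [hset, Set.ncard_image_of_injective _ (smul_left_injective F hw0)]
  have : {c : F | c ≠ 0} = {0}ᶜ := rfl
  rw [this, Set.ncard_compl, Set.ncard_singleton, Nat.card_eq_fintype_card]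

theorem natCard_spreadLine [Fintype F] [Fintype V] (hK : Module.finrank k K = 2) {w : V}
    (hw : w ≠ 0) :
    Nat.card (((Submodule.span F {w}).restrictScalars k).baseChange K) = Fintype.card F ^ 2 := by
  obtain ⟨ω, hω⟩ := exists_frob_ne hK
  have hset : (((Submodule.span F {w}).restrictScalars k).baseChange K : Set (K ⊗[k] V)) =
      (fun c : F × F => (tensorPair ω (c.1 • w) (c.2 • w) : K ⊗[k] V)) '' Set.univ := by
    ext x
    obtain ⟨u, v, rfl⟩ := exists_eq_tensorPair hK hω x
    simp only [SetLike.mem_coe, tensorPair_mem_baseChange hK hω, Submodule.restrictScalars_mem,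
      Submodule.mem_span_singleton, Set.image_univ, Set.mem_range, tensorPair_inj hK hω,
      Prod.exists]
    exact ⟨fun ⟨⟨a, ha⟩, b, hb⟩ => ⟨a, b, ha, hb⟩, fun ⟨a, b, ha, hb⟩ => ⟨⟨a, ha⟩, b, hb⟩⟩
  have h1 := Nat.card_coe_set_eq
    (((Submodule.span F {w}).restrictScalars k).baseChange K : Set (K ⊗[k] V))
  rw [hset, Set.ncard_image_of_injective, Set.ncard_univ, Nat.card_prod,
    Nat.card_eq_fintype_card (α := F), ← sq, ← hset] at h1
  · exact h1
  · rintro ⟨a, b⟩ ⟨a', b'⟩ h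
    have h2 := (tensorPair_inj hK hω).mp h
    exact Prod.ext (smul_left_injective F hw h2.1) (smul_left_injective F hw h2.2)

/-- Double count of the pairs consisting of a generator of an `F`-line and a nonzero vector on the
extension of this line that is orthogonal to `p`. Such an extension is either contained in the polar
hyperplane of `p` or meets it in a hyperplane. -/
theorem ncard_spreadCone_polar [Fintype F] [Fintype V] (hK : Module.finrank k K = 2)
    {h : K ⊗[k] V → K ⊗[k] V → K} (H : IsSkewHermitian k h) (p : K ⊗[k] V) {g : ℤ}
    (hg : (Fintype.card F : ℤ) ^ 2 = (Fintype.card k : ℤ) ^ 2 * g) {D : ℤ}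
    (hD : ({w : V | ∀ y ∈ Submodule.span F {w}, h p (1 ⊗ₜ y) = 0}.ncard : ℤ) = D) :
    ((Fintype.card F : ℤ) - 1) * ({x | x ∈ spreadCone k K V F ∧ h p x = 0}.ncard - 1) =
      (D - 1) * ((Fintype.card F : ℤ) ^ 2 - 1) + (Fintype.card V - D) * (g - 1) := by
  classical
  have := finiteDimensional_of_finrank_two hK
  have : Finite K := Module.finite_of_finite k
  have := Fintype.ofFinite K
  have : Finite (K ⊗[k] V) := by
    obtain ⟨ω, hω⟩ := exists_frob_ne hK
    exact Finite.of_surjective _ (tensorPair_bijective (V := V) hK hω).2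
  have := Fintype.ofFinite (K ⊗[k] V)
  have hcK := card_of_finrank_two hK
  have hq : (Fintype.card k : ℤ) ≠ 0 := by exact_mod_cast Fintype.card_ne_zero
  have hF1 : 1 ≤ Fintype.card F := Fintype.card_pos
  set L : V → Submodule K (K ⊗[k] V) := fun w =>
    ((Submodule.span F {w}).restrictScalars k).baseChange K with hLdef
  have h0 : (0 : K ⊗[k] V) ∈ spreadCone k K V F := ⟨0, zero_mem _⟩
  have h1 := sum_ncard_comm (fun (w : V) (x : K ⊗[k] V) =>
    (w ≠ 0 ∧ x ∈ L w) ∧ x ≠ 0 ∧ h p x = 0)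
  have hR : ∀ x, ({w : V | (w ≠ 0 ∧ x ∈ L w) ∧ x ≠ 0 ∧ h p x = 0}.ncard : ℤ) =
      (if x ∈ spreadCone k K V F ∧ h p x = 0 then (Fintype.card F : ℤ) - 1 else 0) +
      (if x = 0 then -((Fintype.card F : ℤ) - 1) else 0) := by
    intro x
    by_cases hx : x = 0
    · subst hx
      simp [h0, H.zero_right]
    by_cases hpx : h p x = 0
    swap
    · simp [hpx, hx]
    by_cases hxc : x ∈ spreadCone k K V F
    · simp only [hx, hpx, ne_eq, not_false_eq_true, and_true, hxc, if_true, if_false, add_zero]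
      have := ncard_generators hK hx hxc
      rw [this, Nat.cast_sub hF1, Nat.cast_one]
    · have hemp : ∀ w, x ∉ L w := fun w hw => hxc ⟨w, hw⟩
      simp [hemp, hxc, hx]
  have hL : ∀ w : V, ({x | (w ≠ 0 ∧ x ∈ L w) ∧ x ≠ 0 ∧ h p x = 0}.ncard : ℤ) =
      (if ∀ y ∈ Submodule.span F {w}, h p (1 ⊗ₜ y) = 0 then (Fintype.card F : ℤ) ^ 2 - 1
        else g - 1) + (if w = 0 then -((Fintype.card F : ℤ) ^ 2 - 1) else 0) := by
    intro w
    by_cases hw : w = 0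
    · subst hw
      simp [H.zero_right]
    have hcard := natCard_spreadLine (K := K) (k := k) (F := F) hK hw
    -- the zeros of the functional on the extended line
    have hsub : ({x | (w ≠ 0 ∧ x ∈ L w) ∧ x ≠ 0 ∧ h p x = 0}.ncard : ℤ) =
        {x : L w | (H.toDual p).domRestrict (L w) x = 0}.ncard - 1 := by
      have h2 : {x | (w ≠ 0 ∧ x ∈ L w) ∧ x ≠ 0 ∧ h p x = 0} = Subtype.val ''
          ({x : L w | (H.toDual p).domRestrict (L w) x = 0} \ {0}) := by
        ext x
        simp only [Set.mem_ofPred_eq, Set.mem_image, Set.mem_sdiff, Set.mem_singleton_iff]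
        constructor
        · rintro ⟨⟨-, h3⟩, h4, h5⟩
          exact ⟨⟨x, h3⟩, ⟨H.eq_zero_comm.mp h5, fun h6 => h4 (congrArg Subtype.val h6)⟩, rfl⟩
        · rintro ⟨y, ⟨h3, h4⟩, rfl⟩
          exact ⟨⟨hw, y.2⟩, fun h5 => h4 (Subtype.ext h5), H.eq_zero_comm.mp h3⟩
      have hmem : (0 : L w) ∈ {x : L w | (H.toDual p).domRestrict (L w) x = 0} := by simp
      rw [h2, Set.ncard_image_of_injective _ Subtype.val_injective,
        Set.ncard_sdiff_singleton_of_mem hmem, Nat.cast_sub, Nat.cast_one]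
      exact (Set.ncard_pos).mpr ⟨0, hmem⟩
    rw [hsub, if_neg hw, add_zero]
    have hzero : (H.toDual p).domRestrict (L w) = 0 ↔
        ∀ y ∈ Submodule.span F {w}, h p (1 ⊗ₜ y) = 0 := by
      constructor
      · intro h2 y hy
        exact H.eq_zero_comm.mp (LinearMap.congr_fun h2
          ⟨1 ⊗ₜ y, Submodule.tmul_mem_baseChange_of_mem _ hy⟩)
      · intro h2
        obtain ⟨ω, hω⟩ := exists_frob_ne hK
        ext ⟨x, hx⟩
        obtain ⟨u, v, rfl⟩ := exists_eq_tensorPair hK hω x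
        obtain ⟨hu, hv⟩ := (tensorPair_mem_baseChange hK hω).mp hx
        refine H.eq_zero_comm.mp ?_
        have h3 : (tensorPair ω u v : K ⊗[k] V) = 1 ⊗ₜ[k] u + ω • ((1 : K) ⊗ₜ[k] v) := by
          simp [tensorPair, TensorProduct.smul_tmul']
        change h p (tensorPair ω u v) = 0
        rw [h3, H.add_right, H.smul_right, h2 u hu, h2 v hv, mul_zero, add_zero]
    split_ifs with h2
    · have h3 : {x : L w | (H.toDual p).domRestrict (L w) x = 0} = Set.univ := by
        rw [hzero.mpr h2]
        ext
        simp
      rw [h3, Set.ncard_univ, hcard]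
      push_cast
      ring
    · have := Fintype.ofFinite (L w)
      have hne : (H.toDual p).domRestrict (L w) ≠ 0 := fun h3 => h2 (hzero.mp h3)
      have h3 := ncard_ker_mul_card (F := K) (W := L w) (φ := (H.toDual p).domRestrict (L w)) hne
      rw [← Nat.card_eq_fintype_card (α := L w), hcard, hcK] at h3
      have h4 : ({x : L w | (H.toDual p).domRestrict (L w) x = 0}.ncard : ℤ) *
          (Fintype.card k : ℤ) ^ 2 = (Fintype.card k : ℤ) ^ 2 * g := by
        rw [← hg]
        exact_mod_cast h3
      rw [mul_comm] at h4
      rw [mul_left_cancel₀ (pow_ne_zero 2 hq) h4]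
  simp_rw [hL, hR] at h1
  rw [Finset.sum_add_distrib, Finset.sum_add_distrib, sum_ite_const, sum_ite_const,
    sum_ite_const, sum_ite_const, hD] at h1
  simp only [Set.ofPred_eq_eq_singleton, Set.ncard_singleton, Nat.cast_one] at h1
  linear_combination -h1

end SpreadCone

/-! ### Tight sets as cones of vectors -/

section TightCone

variable {K W : Type*} [Field K] [AddCommGroup W] [Module K W]

theorem ncard_mul_card_sub_one [Fintype K] [Finite W] (A : Set (ℙ K W)) :
    (A.ncard : ℤ) * (Fintype.card K - 1) =
      {x : W | ∃ hx : x ≠ 0, Projectivization.mk K x hx ∈ A}.ncard := by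
  classical
  have := Fintype.ofFinite W
  have := Fintype.ofFinite (ℙ K W)
  have h1 := sum_ncard_comm (fun (P : ℙ K W) (x : W) =>
    P ∈ A ∧ ∃ hx : x ≠ 0, Projectivization.mk K x hx = P)
  have hL : ∀ P : ℙ K W, ({x : W | P ∈ A ∧ ∃ hx : x ≠ 0, Projectivization.mk K x hx = P}.ncard : ℤ)
      = if P ∈ A then (Fintype.card K : ℤ) - 1 else 0 := by
    intro P
    split_ifs with hP
    · have hset : {x : W | P ∈ A ∧ ∃ hx : x ≠ 0, Projectivization.mk K x hx = P} =
          (fun c : K => c • P.rep) '' {0}ᶜ := by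
        ext x
        simp only [Set.mem_ofPred_eq, Set.mem_image, Set.mem_compl_iff, Set.mem_singleton_iff]
        constructor
        · rintro ⟨-, hx, rfl⟩
          obtain ⟨a, ha⟩ := Projectivization.exists_smul_eq_mk_rep K x hx
          exact ⟨(a⁻¹ : Kˣ), a⁻¹.ne_zero, by rw [← ha, ← Units.smul_def, inv_smul_smul]⟩
        · rintro ⟨c, hc, rfl⟩
          refine ⟨hP, smul_ne_zero hc P.rep_nonzero, ?_⟩
          conv_rhs => rw [← P.mk_rep]
          exact (Projectivization.mk_eq_mk_iff' _ _ _ _ _).mpr ⟨c, rfl⟩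
      rw [hset, Set.ncard_image_of_injective _ (smul_left_injective K P.rep_nonzero),
        Set.ncard_compl, Set.ncard_singleton, Nat.card_eq_fintype_card,
        Nat.cast_sub Fintype.card_pos, Nat.cast_one]
    · simp [hP]
  have hR : ∀ x : W, ({P : ℙ K W | P ∈ A ∧ ∃ hx : x ≠ 0, Projectivization.mk K x hx = P}.ncard : ℤ)
      = if ∃ hx : x ≠ 0, Projectivization.mk K x hx ∈ A then 1 else 0 := by
    intro x
    split_ifs with hx
    · obtain ⟨hx, hxA⟩ := hx
      have hset : {P : ℙ K W | P ∈ A ∧ ∃ hx : x ≠ 0, Projectivization.mk K x hx = P} =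
          {Projectivization.mk K x hx} := by
        ext P
        simp only [Set.mem_ofPred_eq, Set.mem_singleton_iff]
        exact ⟨fun ⟨_, _, h⟩ => h.symm, fun h => ⟨h ▸ hxA, hx, h.symm⟩⟩
      rw [hset, Set.ncard_singleton, Nat.cast_one]
    · have hset : {P : ℙ K W | P ∈ A ∧ ∃ hx : x ≠ 0, Projectivization.mk K x hx = P} = ∅ := by
        rw [Set.eq_empty_iff_forall_notMem]
        rintro P ⟨hP, hx', rfl⟩
        exact hx ⟨hx', hP⟩
      rw [hset, Set.ncard_empty, Nat.cast_zero]
  simp_rw [hL, hR] at h1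
  rw [sum_ite_const, sum_ite_const] at h1
  simpa using h1

/-- The condition defining an `i`-tight set of points, in terms of the set `S` of vectors, including
the zero vector, on these points. Here `M = q^{r-1}`. -/
def IsTightCone (q : ℕ) (M : ℤ) (h : W → W → K) (i : ℤ) (S : Set W) : Prop :=
  ∀ p : W, p ≠ 0 → h p p = 0 →
    (p ∈ S → ({x | x ∈ S ∧ h p x = 0}.ncard : ℤ) = i * (M - 1) + M * ((q : ℤ) ^ 2 - 1) + 1) ∧
    (p ∉ S → ({x | x ∈ S ∧ h p x = 0}.ncard : ℤ) = i * (M - 1) + 1)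

omit [Module K W] in
theorem IsTightCone.sdiff_union [Finite W] {q : ℕ} {M : ℤ} {h : W → W → K} {i j l : ℤ}
    {S T U : Set W} (hS : IsTightCone q M h i S) (hT : IsTightCone q M h j T)
    (hU : IsTightCone q M h l U) (hTS : T ⊆ S) (hUT : U ⊆ T) :
    IsTightCone q M h (i - j + l) ((S \ T) ∪ U) := by
  intro p hp hpp
  have hcount : ({x | x ∈ (S \ T) ∪ U ∧ h p x = 0}.ncard : ℤ) =
      {x | x ∈ S ∧ h p x = 0}.ncard - {x | x ∈ T ∧ h p x = 0}.ncard +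
        {x | x ∈ U ∧ h p x = 0}.ncard := by
    classical
    have := Fintype.ofFinite W
    simp only [ncard_setOf_eq_sum]
    rw [← Finset.sum_sub_distrib, ← Finset.sum_add_distrib]
    refine Finset.sum_congr rfl fun x _ => ?_
    have h1 := @hTS x
    have h2 := @hUT x
    by_cases hxS : x ∈ S <;> by_cases hxT : x ∈ T <;> by_cases hxU : x ∈ U <;>
      by_cases hx0 : h p x = 0 <;> simp_all
  rw [hcount]
  have h1 := @hTS p
  have h2 := @hUT p
  have hS := hS p hp hpp
  have hT := hT p hp hpp
  have hU := hU p hp hpp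
  constructor
  · rintro (⟨hpS, hpT⟩ | hpU)
    · rw [hS.1 hpS, hT.2 hpT, hU.2 fun h => hpT (h2 h)]
      ring
    · rw [hS.1 (h1 (h2 hpU)), hT.1 (h2 hpU), hU.1 hpU]
      ring
  · intro hpn
    rw [Set.mem_union, not_or, Set.mem_sdiff, not_and_not_right] at hpn
    rw [hU.2 hpn.2]
    by_cases hpS : p ∈ S
    · rw [hS.1 hpS, hT.1 (hpn.1 hpS)]
      ring
    · rw [hS.2 hpS, hT.2 fun h => hpS (h1 h)]
      ring

theorem theta_mul (m Q : ℕ) : (theta m Q : ℤ) * (Q - 1) = (Q : ℤ) ^ (m + 1) - 1 := by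
  rw [theta]
  push_cast
  exact geom_sum_mul _ _

variable {k : Type*} [Field k] [Fintype k] [Algebra k K]

theorem IsSkewHermitian.orthogonal_mk {h : W → W → K} (H : IsSkewHermitian k h) {x y : W}
    (hx : x ≠ 0) (hy : y ≠ 0) :
    Orthogonal h (Projectivization.mk K x hx) (Projectivization.mk K y hy) ↔ h x y = 0 := by
  simp only [Orthogonal, Projectivization.submodule_mk]
  constructor
  · intro h1
    exact h1 x (Submodule.mem_span_singleton_self x) y (Submodule.mem_span_singleton_self y)
  · intro h1 x' hx' y' hy'
    obtain ⟨a, rfl⟩ := Submodule.mem_span_singleton.mp hx'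
    obtain ⟨b, rfl⟩ := Submodule.mem_span_singleton.mp hy'
    rw [H.smul_left, H.smul_right, h1, mul_zero, mul_zero]

theorem isTight_of_isTightCone [Finite W] (hK : Module.finrank k K = 2) {n : ℕ} (hn : 1 ≤ n)
    {h : W → W → K} (H : IsSkewHermitian k h) {i : ℕ} {S : Set W} {X : Set (ℙ K W)}
    (hS0 : (0 : W) ∈ S) (hX : X ⊆ isotropicPoints h)
    (hSX : ∀ x (hx : x ≠ 0), Projectivization.mk K x hx ∈ X ↔ x ∈ S)
    (hS : IsTightCone (Fintype.card k) ((Fintype.card k : ℤ) ^ (4 * n - 2)) h i S) :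
    IsTight (Fintype.card k) (4 * n - 1) h i X := by
  have := finiteDimensional_of_finrank_two hK
  have : Finite K := Module.finite_of_finite k
  have := Fintype.ofFinite K
  have hq1 : 1 < Fintype.card k := Fintype.one_lt_card
  set q := Fintype.card k with hq
  have hcK : (Fintype.card K : ℤ) = (q : ℤ) ^ 2 := by exact_mod_cast card_of_finrank_two hK
  have hne : (q : ℤ) ^ 2 - 1 ≠ 0 := by
    have : (1 : ℤ) < (q : ℤ) ^ 2 := one_lt_pow₀ (by exact_mod_cast hq1) two_ne_zero
    omega
  refine ⟨hX, fun P => ?_⟩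
  induction P using Projectivization.ind with | h p hp => ?_
  intro hpp
  have hpp' : h p p = 0 := (H.orthogonal_mk hp hp).mp hpp
  have hθ : (theta ((4 * n - 1 - 3) / 2) (q ^ 2) : ℤ) * ((q : ℤ) ^ 2 - 1) =
      (q : ℤ) ^ (4 * n - 2) - 1 := by
    have h1 := theta_mul ((4 * n - 1 - 3) / 2) (q ^ 2)
    push_cast at h1
    rw [h1, ← pow_mul]
    congr 2
    omega
  have hr : 4 * n - 1 - 1 = 4 * n - 2 := by omega
  have hcount : ((polar h (Projectivization.mk K p hp) ∩ X).ncard : ℤ) * ((q : ℤ) ^ 2 - 1) + 1 =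
      {x | x ∈ S ∧ h p x = 0}.ncard := by
    rw [← hcK, ncard_mul_card_sub_one]
    have hset : {x : W | x ∈ S ∧ h p x = 0} = insert 0 {x : W | ∃ hx : x ≠ 0,
        Projectivization.mk K x hx ∈ polar h (Projectivization.mk K p hp) ∩ X} := by
      ext x
      simp only [Set.mem_insert_iff, Set.mem_ofPred_eq, Set.mem_inter_iff]
      by_cases hx : x = 0
      · subst hx
        simp [hS0, H.zero_right]
      · simp only [hx, hSX, ne_eq, not_false_eq_true, exists_true_left, false_or, polar,
          Set.mem_ofPred_eq, H.orthogonal_mk, and_comm]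
    rw [hset, Set.ncard_insert_of_notMem]
    · push_cast
      rfl
    · rintro ⟨h0, -⟩
      exact h0 rfl
  have hS := hS p hp hpp'
  rw [hSX, hr]
  constructor
  · intro hpS
    have h1 := hS.1 hpS
    rw [← hcount] at h1
    zify
    apply mul_right_cancel₀ hne
    linear_combination h1 - i * hθ
  · intro hpS
    have h1 := hS.2 hpS
    rw [← hcount] at h1
    zify
    apply mul_right_cancel₀ hne
    linear_combination h1 - i * hθ

end TightCone

/-! ### Tightness of the basic cones -/

section BasicCones

variable {k K V : Type*} [Field k] [Fintype k] [Field K] [Algebra k K] [AddCommGroup V]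

section
variable [Module k V] [Fintype V] {f : LinearMap.BilinForm k V} {M : ℤ}

theorem ncard_tensorForm_self (hK : Module.finrank k K = 2) (hf : f.IsAlt)
    (hf' : f.Nondegenerate) (hM : (Fintype.card V : ℤ) = (Fintype.card k : ℤ) ^ 2 * M) :
    ({x : K ⊗[k] V | tensorForm K f x x = 0}.ncard : ℤ) =
      (Fintype.card k : ℤ) ^ 2 * M + ((Fintype.card k : ℤ) ^ 2 * M - 1) * (Fintype.card k * M) := by
  classical
  obtain ⟨ω, hω⟩ := exists_frob_ne hK
  have hq : (Fintype.card k : ℤ) ≠ 0 := by exact_mod_cast Fintype.card_ne_zero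
  have hset : {x : K ⊗[k] V | tensorForm K f x x = 0} =
      (fun p : V × V => (tensorPair ω p.1 p.2 : K ⊗[k] V)) '' {p | f p.1 p.2 = 0} := by
    ext x
    obtain ⟨u, v, rfl⟩ := exists_eq_tensorPair hK hω x
    simp only [Set.mem_ofPred_eq, tensorForm_self_eq_zero hf hω, Set.mem_image, Prod.exists,
      tensorPair_inj hK hω]
    exact ⟨fun h => ⟨u, v, h, rfl, rfl⟩, by rintro ⟨_, _, h, rfl, rfl⟩; exact h⟩
  rw [hset, Set.ncard_image_of_injective _ (tensorPair_bijective hK hω).1, ncard_setOf_eq_sum,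
    Fintype.sum_prod_type]
  have hu : ∀ u : V, (∑ v : V, if f u v = 0 then (1 : ℤ) else 0) =
      if u = 0 then (Fintype.card k : ℤ) ^ 2 * M else Fintype.card k * M := by
    intro u
    rw [← ncard_setOf_eq_sum]
    split_ifs with h
    · subst h
      rw [← hM]
      simp
    · have h1 := ncard_ker_mul_card (φ := f u) fun h0 =>
        h (hf'.1 u fun y => LinearMap.congr_fun h0 y)
      apply mul_left_cancel₀ hq
      zify at h1
      linear_combination h1 + hM
  simp only [hu]
  rw [sum_ite_const, hM]
  simp only [Set.ofPred_eq_eq_singleton, Set.ncard_singleton, Nat.cast_one]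
  ring

theorem card_tensor (hK : Module.finrank k K = 2) [Fintype (K ⊗[k] V)]
    (hM : (Fintype.card V : ℤ) = (Fintype.card k : ℤ) ^ 2 * M) :
    (Fintype.card (K ⊗[k] V) : ℤ) =
      (Fintype.card k : ℤ) ^ 2 * ((Fintype.card k : ℤ) ^ 2 * M ^ 2) := by
  obtain ⟨ω, hω⟩ := exists_frob_ne hK
  rw [← Fintype.card_congr (Equiv.ofBijective _ (tensorPair_bijective (V := V) hK hω)),
    Fintype.card_prod]
  push_cast
  rw [hM]
  ring

/-- The number of vectors of a Hermitian variety in a tangent hyperplane. -/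
theorem ncard_tensorForm_tangent (hK : Module.finrank k K = 2) (hf : f.IsAlt)
    (hf' : f.Nondegenerate) (hM : (Fintype.card V : ℤ) = (Fintype.card k : ℤ) ^ 2 * M)
    {p : K ⊗[k] V} (hp : p ≠ 0) (hpp : tensorForm K f p p = 0) :
    ({x | tensorForm K f p x = 0 ∧ tensorForm K f x x = 0}.ncard : ℤ) =
      Fintype.card k * M ^ 2 + (Fintype.card k : ℤ) ^ 2 * M - Fintype.card k * M := by
  have hq : (Fintype.card k : ℤ) ≠ 0 := by exact_mod_cast Fintype.card_ne_zero
  have := Fintype.ofBijective _ (tensorPair_bijective (V := V) hK (exists_frob_ne hK).choose_spec)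
  have h1 := (isSkewHermitian_tensorForm hK hf).ncard_tangent_section hK hpp
    (exists_tensorForm_ne_zero hK hf' hp) (card_tensor hK hM)
  rw [ncard_tensorForm_self hK hf hf' hM] at h1
  apply mul_left_cancel₀ hq
  linear_combination h1

/-- The number of vectors of a Hermitian variety in a non-tangent hyperplane. -/
theorem ncard_tensorForm_nontangent (hK : Module.finrank k K = 2) (hf : f.IsAlt)
    (hf' : f.Nondegenerate) (hM : (Fintype.card V : ℤ) = (Fintype.card k : ℤ) ^ 2 * M)
    {p : K ⊗[k] V} (hpp : tensorForm K f p p ≠ 0) :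
    ({x | tensorForm K f p x = 0 ∧ tensorForm K f x x = 0}.ncard : ℤ) =
      Fintype.card k * M ^ 2 - Fintype.card k * M + M := by
  have hq : (Fintype.card k : ℤ) ≠ 0 := by exact_mod_cast Fintype.card_ne_zero
  have := Fintype.ofBijective _ (tensorPair_bijective (V := V) hK (exists_frob_ne hK).choose_spec)
  have h1 := (isSkewHermitian_tensorForm hK hf).ncard_nontangent_section hK hpp (card_tensor hK hM)
  rw [ncard_tensorForm_self hK hf hf' hM] at h1
  apply mul_left_cancel₀ hq
  linear_combination h1

theorem isTightCone_isotropic (hK : Module.finrank k K = 2) (hf : f.IsAlt) (hf' : f.Nondegenerate)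
    (hM : (Fintype.card V : ℤ) = (Fintype.card k : ℤ) ^ 2 * M) :
    IsTightCone (Fintype.card k) M (tensorForm K f) (Fintype.card k * M + 1)
      {x | tensorForm K f x x = 0} := by
  intro p hp hpp
  refine ⟨fun _ => ?_, fun h => absurd hpp h⟩
  simp only [Set.mem_ofPred_eq, and_comm (b := tensorForm K f p _ = 0)]
  rw [ncard_tensorForm_tangent hK hf hf' hM hp hpp]
  ring

theorem isTightCone_spreadCone_self (hK : Module.finrank k K = 2) (hf : f.IsAlt)
    (hf' : f.Nondegenerate) (hM : (Fintype.card V : ℤ) = (Fintype.card k : ℤ) ^ 2 * M) :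
    IsTightCone (Fintype.card k) M (tensorForm K f) (Fintype.card k + 1)
      (spreadCone k K V k) := by
  intro p hp hpp
  have hq : (Fintype.card k : ℤ) ≠ 0 := by exact_mod_cast Fintype.card_ne_zero
  have hq1 : (Fintype.card k : ℤ) - 1 ≠ 0 := by
    have : 1 < Fintype.card k := Fintype.one_lt_card
    omega
  have hcount := ncard_spreadCone_polar (F := k) hK (isSkewHermitian_tensorForm hK hf) p
    (g := 1) (by ring) rfl
  obtain ⟨ω, hω⟩ := exists_frob_ne hK
  obtain ⟨u, v, rfl⟩ := exists_eq_tensorPair hK hω p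
  have huv : ¬ (u = 0 ∧ v = 0) := fun h => hp (by rw [h.1, h.2, tensorPair_zero])
  have hD : {w : V | ∀ y ∈ Submodule.span k {w},
      tensorForm K f (tensorPair ω u v) (1 ⊗ₜ y) = 0} = {w : V | f u w = 0 ∧ f v w = 0} := by
    ext w
    simp only [tensorForm_tensorPair_one_tmul_eq_zero hω, Set.mem_ofPred_eq]
    constructor
    · intro h
      exact h w (Submodule.mem_span_singleton_self w)
    · intro h y hy
      obtain ⟨c, rfl⟩ := Submodule.mem_span_singleton.mp hy
      simp [h]
  rw [hD] at hcount
  rw [tensorPair_mem_spreadCone k hK hω, not_not]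
  constructor
  · intro h
    have h1 := ncard_orthogonal_pair_of_not_linearIndependent hf' h huv
    zify at h1
    rw [hM] at h1
    have h2 : ({w : V | f u w = 0 ∧ f v w = 0}.ncard : ℤ) = Fintype.card k * M := by
      apply mul_left_cancel₀ hq
      linear_combination h1
    rw [h2] at hcount
    apply mul_left_cancel₀ hq1
    linear_combination hcount
  · intro h
    have h1 := ncard_orthogonal_pair_of_linearIndependent hf' h
    zify at h1
    rw [hM] at h1
    have h2 : ({w : V | f u w = 0 ∧ f v w = 0}.ncard : ℤ) = M := by
      apply mul_left_cancel₀ (pow_ne_zero 2 hq)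
      linear_combination h1
    rw [h2] at hcount
    apply mul_left_cancel₀ hq1
    linear_combination hcount

end

section

variable [Module K V] [Module k V] [IsScalarTower k K V] [Fintype V] {B : LinearMap.BilinForm K V}
  {M : ℤ}

theorem isTightCone_spreadCone (hK : Module.finrank k K = 2) (hB : B.IsAlt)
    (hB' : B.Nondegenerate) {b : K} (hb : b ≠ 0)
    (hM : (Fintype.card V : ℤ) = (Fintype.card k : ℤ) ^ 2 * M) :
    IsTightCone (Fintype.card k) M (hermitianForm k B b) ((Fintype.card k : ℤ) ^ 2 + 1)
      (spreadCone k K V K) := by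
  intro p hp hpp
  have := finiteDimensional_of_finrank_two hK
  have : Finite K := Module.finite_of_finite k
  have := Fintype.ofFinite K
  have hcK := card_of_finrank_two hK
  have hq : (Fintype.card k : ℤ) ≠ 0 := by exact_mod_cast Fintype.card_ne_zero
  have hq1 : (Fintype.card k : ℤ) ^ 2 - 1 ≠ 0 := by
    have h1 : 1 < Fintype.card k := Fintype.one_lt_card
    have : (1 : ℤ) < (Fintype.card k : ℤ) ^ 2 := one_lt_pow₀ (by exact_mod_cast h1) two_ne_zero
    omega
  have hf := pencilForm_isAlt (k := k) hB b
  have hcount := ncard_spreadCone_polar (F := K) hK (isSkewHermitian_tensorForm hK hf) p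
    (g := (Fintype.card k : ℤ) ^ 2) (by rw [hcK]; push_cast; ring) rfl
  obtain ⟨ω, hω⟩ := exists_frob_ne hK
  obtain ⟨u, v, rfl⟩ := exists_eq_tensorPair hK hω p
  have huv : ¬ (u = 0 ∧ v = 0) := fun h => hp (by rw [h.1, h.2, tensorPair_zero])
  have hD : {w : V | ∀ y ∈ Submodule.span K {w},
      tensorForm K (pencilForm k B b) (tensorPair ω u v) (1 ⊗ₜ y) = 0} =
      {w : V | B u w = 0 ∧ B v w = 0} := by
    ext w
    simp only [tensorForm_tensorPair_one_tmul_eq_zero hω, Set.mem_ofPred_eq,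
      Submodule.mem_span_singleton, forall_exists_index, forall_apply_eq_imp_iff, forall_and,
      forall_pencilForm_smul_eq_zero hK hb]
  rw [hD, hM] at hcount
  rw [tensorPair_mem_spreadCone K hK hω, not_not, hermitianForm_eq]
  rw [hcK] at hcount
  push_cast at hcount
  constructor
  · intro h
    have h1 := ncard_orthogonal_pair_of_not_linearIndependent hB' h huv
    rw [hcK] at h1
    zify at h1
    rw [hM] at h1
    have h2 : ({w : V | B u w = 0 ∧ B v w = 0}.ncard : ℤ) = M := by
      apply mul_left_cancel₀ (pow_ne_zero 2 hq)
      linear_combination h1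
    rw [h2] at hcount
    apply mul_left_cancel₀ hq1
    linear_combination hcount
  · intro h
    have h1 := ncard_orthogonal_pair_of_linearIndependent hB' h
    rw [hcK] at h1
    zify at h1
    rw [hM] at h1
    have h2 : (Fintype.card k : ℤ) ^ 2 * ({w : V | B u w = 0 ∧ B v w = 0}.ncard : ℤ) = M := by
      apply mul_left_cancel₀ (pow_ne_zero 2 hq)
      linear_combination h1
    rw [← h2]
    rw [← h2] at hcount
    apply mul_left_cancel₀ hq1
    linear_combination hcount

variable (k B) in
/-- The set of the vectors of `K ⊗ V` that are isotropic for all forms of the pencil. -/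
def pencilCone : Set (K ⊗[k] V) := {x | ∀ c : K, hermitianForm k B c x x = 0}

omit [Fintype V] in
theorem hermitianForm_self_eq_zero (hB : B.IsAlt) {ω : K} (hω : frob k K ω ≠ ω) {c : K} {u v : V} :
    hermitianForm k B c (tensorPair ω u v) (tensorPair ω u v) = 0 ↔
      Algebra.trace k K (c * B u v) = 0 :=
  tensorForm_self_eq_zero (pencilForm_isAlt hB c) hω

omit [Fintype V] in
theorem tensorPair_mem_pencilCone (hK : Module.finrank k K = 2) (hB : B.IsAlt) {ω : K}
    (hω : frob k K ω ≠ ω) {u v : V} : tensorPair ω u v ∈ pencilCone k B ↔ B u v = 0 := by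
  simp only [pencilCone, Set.mem_ofPred_eq, hermitianForm_self_eq_zero hB hω]
  constructor
  · exact eq_zero_of_forall_trace_mul hK
  · intro h c
    rw [h, mul_zero, map_zero]

theorem ncard_trace_mul_eq_zero [Fintype K] (hK : Module.finrank k K = 2) {z : K} (hz : z ≠ 0) :
    ({c : K | c ≠ 0 ∧ Algebra.trace k K (c * z) = 0}.ncard : ℤ) = Fintype.card k - 1 := by
  have h1 : {c : K | c ≠ 0 ∧ Algebra.trace k K (c * z) = 0} =
      (fun y => y * z⁻¹) '' ({y : K | Algebra.trace k K y = 0} \ {0}) := by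
    ext c
    simp only [Set.mem_ofPred_eq, Set.mem_image, Set.mem_sdiff, Set.mem_singleton_iff]
    constructor
    · rintro ⟨hc, hc'⟩
      exact ⟨c * z, ⟨hc', mul_ne_zero hc hz⟩, mul_inv_cancel_right₀ hz c⟩
    · rintro ⟨y, ⟨hy, hy'⟩, rfl⟩
      exact ⟨mul_ne_zero hy' (inv_ne_zero hz), by rwa [inv_mul_cancel_right₀ hz]⟩
  rw [h1, Set.ncard_image_of_injective _ (mul_left_injective₀ (inv_ne_zero hz)),
    Set.ncard_sdiff_singleton_of_mem (by simp), ncard_trace_eq hK,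
    Nat.cast_sub Fintype.card_pos, Nat.cast_one]

/-- Count in two ways the pairs consisting of a scalar `c ≠ 0` and a vector of the polar hyperplane
of `p` with respect to `h_b` that is isotropic for `h_c`. A vector outside the pencil cone is
isotropic for `q - 1` of the forms `h_c`. The hyperplane is tangent to the varieties of all `h_c` if
`p` is in the pencil cone, and to those of `q - 1` forms `h_c` otherwise. -/
theorem isTightCone_pencilCone (hK : Module.finrank k K = 2) (hB : B.IsAlt)
    (hB' : B.Nondegenerate) {b : K} (hb : b ≠ 0)
    (hM : (Fintype.card V : ℤ) = (Fintype.card k : ℤ) ^ 2 * M) :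
    IsTightCone (Fintype.card k) M (hermitianForm k B b) (M + 1) (pencilCone k B) := by
  classical
  intro p hp _
  have := finiteDimensional_of_finrank_two hK
  have : Finite K := Module.finite_of_finite k
  have := Fintype.ofFinite K
  have hcK := card_of_finrank_two hK
  have hq : (Fintype.card k : ℤ) ≠ 0 := by exact_mod_cast Fintype.card_ne_zero
  have hq1 : (Fintype.card k : ℤ) - 1 ≠ 0 := by
    have : 1 < Fintype.card k := Fintype.one_lt_card
    omega
  have := Fintype.ofBijective _ (tensorPair_bijective (V := V) hK (exists_frob_ne hK).choose_spec)
  obtain ⟨ω, hω⟩ := exists_frob_ne hK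
  set h := hermitianForm k B b
  have H : IsSkewHermitian k h := isSkewHermitian_tensorForm hK (pencilForm_isAlt hB b)
  have hcW := card_tensor (V := V) hK hM
  have hpolar : ({x | h p x = 0}.ncard : ℤ) = (Fintype.card k : ℤ) ^ 2 * M ^ 2 := by
    have h1 := H.ncard_polar_mul_card
      (exists_tensorForm_ne_zero hK (pencilForm_nondegenerate hK hB hB' hb) hp)
    rw [hcK] at h1
    zify at h1
    rw [hcW] at h1
    apply mul_left_cancel₀ (pow_ne_zero 2 hq)
    linear_combination h1
  have h1 := sum_ncard_comm (fun (c : K) (x : K ⊗[k] V) =>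
    c ≠ 0 ∧ h p x = 0 ∧ hermitianForm k B c x x = 0)
  have hR : ∀ x, ({c : K | c ≠ 0 ∧ h p x = 0 ∧ hermitianForm k B c x x = 0}.ncard : ℤ) =
      (if x ∈ pencilCone k B ∧ h p x = 0 then (Fintype.card k : ℤ) ^ 2 - Fintype.card k else 0) +
      (if h p x = 0 then (Fintype.card k : ℤ) - 1 else 0) := by
    intro x
    by_cases hpx : h p x = 0
    swap
    · simp [hpx]
    by_cases hx : x ∈ pencilCone k B
    · have hx' : ∀ c, hermitianForm k B c x x = 0 := hx
      have h2 : {c : K | c ≠ 0} = {0}ᶜ := rfl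
      simp only [hpx, hx, hx', and_true, if_true, h2]
      rw [Set.ncard_compl, Set.ncard_singleton, Nat.card_eq_fintype_card,
        Nat.cast_sub Fintype.card_pos, hcK]
      push_cast
      ring
    · simp only [hpx, hx, true_and, false_and, if_true, if_false, zero_add]
      obtain ⟨u, v, rfl⟩ := exists_eq_tensorPair hK hω x
      rw [tensorPair_mem_pencilCone hK hB hω] at hx
      simp only [hermitianForm_self_eq_zero hB hω]
      exact ncard_trace_mul_eq_zero hK hx
  obtain ⟨u, v, rfl⟩ := exists_eq_tensorPair hK hω p
  have hL : ∀ c : K, ({x | c ≠ 0 ∧ h (tensorPair ω u v) x = 0 ∧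
      hermitianForm k B c x x = 0}.ncard : ℤ) =
      (if c ≠ 0 then Fintype.card k * M ^ 2 - Fintype.card k * M + M else 0) +
      (if c ≠ 0 ∧ Algebra.trace k K (c⁻¹ * (b ^ 2 * B u v)) = 0
        then M * ((Fintype.card k : ℤ) ^ 2 - 1) else 0) := by
    intro c
    by_cases hc : c = 0
    · simp [hc]
    -- for `h_c` the hyperplane is the polar of `(b / c) p`; it is tangent if this is isotropic
    have hval : Algebra.trace k K (c⁻¹ * (b ^ 2 * B u v)) = 0 ↔
        tensorForm K (pencilForm k B c) (tensorPair ω ((b / c) • u) ((b / c) • v))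
          (tensorPair ω ((b / c) • u) ((b / c) • v)) = 0 := by
      rw [← hermitianForm_eq, hermitianForm_self_eq_zero hB hω, map_smul, map_smul,
        LinearMap.smul_apply, smul_eq_mul, smul_eq_mul]
      have : c * (b / c * (b / c * B u v)) = c⁻¹ * (b ^ 2 * B u v) := by
        field_simp
      rw [this]
    have hne : (tensorPair ω ((b / c) • u) ((b / c) • v) : K ⊗[k] V) ≠ 0 := by
      intro h0
      rw [← tensorPair_zero (ω := ω), tensorPair_inj hK hω] at h0
      have hbc : b / c ≠ 0 := div_ne_zero hb hc
      rw [smul_eq_zero_iff_right hbc, smul_eq_zero_iff_right hbc] at h0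
      exact hp (by rw [h0.1, h0.2, tensorPair_zero])
    have hf := pencilForm_isAlt (k := k) hB c
    have hf' := pencilForm_nondegenerate (k := k) hK hB hB' hc
    have hpol : ∀ x, h (tensorPair ω u v) x =
        tensorForm K (pencilForm k B c) (tensorPair ω ((b / c) • u) ((b / c) • v)) x :=
      hermitianForm_eq_hermitianForm_smul hc hK hω u v
    simp only [hpol, hc, ne_eq, not_false_eq_true, true_and, if_true, hermitianForm_eq]
    by_cases ht : Algebra.trace k K (c⁻¹ * (b ^ 2 * B u v)) = 0
    · rw [if_pos ht, ncard_tensorForm_tangent hK hf hf' hM hne (hval.mp ht)]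
      ring
    · rw [if_neg ht, ncard_tensorForm_nontangent hK hf hf' hM (mt hval.mpr ht)]
      ring
  have hunits : ({c : K | c ≠ 0}.ncard : ℤ) = (Fintype.card k : ℤ) ^ 2 - 1 := by
    have h2 : {c : K | c ≠ 0} = {0}ᶜ := rfl
    rw [h2, Set.ncard_compl, Set.ncard_singleton, Nat.card_eq_fintype_card,
      Nat.cast_sub Fintype.card_pos, hcK]
    push_cast
    ring
  simp_rw [hL, hR] at h1
  rw [Finset.sum_add_distrib, Finset.sum_add_distrib, sum_ite_const, sum_ite_const,
    sum_ite_const, sum_ite_const, hpolar, hunits] at h1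
  rw [tensorPair_mem_pencilCone hK hB hω]
  constructor
  · intro huv
    simp only [huv, mul_zero, map_zero, and_true, hunits] at h1
    apply mul_left_cancel₀ hq
    apply mul_left_cancel₀ hq1
    linear_combination -h1
  · intro huv
    have hinv : {c : K | c ≠ 0 ∧ Algebra.trace k K (c⁻¹ * (b ^ 2 * B u v)) = 0} =
        Inv.inv '' {c : K | c ≠ 0 ∧ Algebra.trace k K (c * (b ^ 2 * B u v)) = 0} := by
      ext c
      simp
    rw [hinv, Set.ncard_image_of_injective _ inv_injective,
      ncard_trace_mul_eq_zero hK (mul_ne_zero (pow_ne_zero 2 hb) huv)] at h1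
    apply mul_left_cancel₀ hq
    apply mul_left_cancel₀ hq1
    linear_combination -h1

end
end BasicCones

/-! ### Transitivity of the symplectic group on pairs of vectors -/

section Witt

variable {K V : Type*} [Field K] [AddCommGroup V] [Module K V] {B : LinearMap.BilinForm K V}

theorem exists_apply_ne_zero_and {φ ψ : V →ₗ[K] K} (hφ : ∃ x, φ x ≠ 0) (hψ : ∃ x, ψ x ≠ 0) :
    ∃ x, φ x ≠ 0 ∧ ψ x ≠ 0 := by
  obtain ⟨x, hx⟩ := hφ
  obtain ⟨y, hy⟩ := hψ
  by_cases hx' : ψ x = 0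
  · by_cases hy' : φ y = 0
    · exact ⟨x + y, by simpa [hy'] using hx, by simpa [hx'] using hy⟩
    · exact ⟨y, hy', hy⟩
  · exact ⟨x, hx, hx'⟩

theorem apply_ne_zero_comm (hB : B.IsAlt) {u v : V} (h : B u v ≠ 0) : B v u ≠ 0 := by
  rwa [← hB.neg_eq, neg_ne_zero]

theorem exists_apply_ne_zero (hB : B.Nondegenerate) {u : V} (hu : u ≠ 0) : ∃ x, B u x ≠ 0 := by
  by_contra! h
  exact hu (hB.1 u h)

theorem linearIndependent_of_apply_ne_zero (hB : B.IsAlt) {u v : V} (h : B u v ≠ 0) :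
    LinearIndependent K ![u, v] := by
  by_contra h'
  obtain ⟨w, hu, hv⟩ := exists_mem_span_of_not_linearIndependent h'
  obtain ⟨a, rfl⟩ := Submodule.mem_span_singleton.mp hu
  obtain ⟨b, rfl⟩ := Submodule.mem_span_singleton.mp hv
  simp [hB w] at h

/-- The transvection in the direction `u' - u` that maps `u` to `u'`. -/
theorem exists_symplectic_of_apply_ne_zero (hB : B.IsAlt) {u u' : V} (h : B u u' ≠ 0) :
    ∃ g ∈ symplecticGroup B, g u = u' ∧ ∀ x, B (u' - u) x = 0 → g x = x := by
  set w := u' - u with hw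
  have hf : ((B u' u)⁻¹ • B w) w = 0 := by
    rw [LinearMap.smul_apply, hB w, smul_zero]
  have happ : ∀ x, LinearEquiv.transvection hf x = x + ((B u' u)⁻¹ * B w x) • w := fun x => rfl
  refine ⟨LinearEquiv.transvection hf, fun x y => ?_, ?_, fun x hx => ?_⟩
  · rw [happ, happ]
    simp only [map_add, LinearMap.add_apply, map_smul, LinearMap.smul_apply, smul_eq_mul, hB w,
      ← hB.neg_eq w x]
    ring
  · have h1 : B w u = B u' u := by rw [hw, map_sub, LinearMap.sub_apply, hB u, sub_zero]
    rw [happ, h1, inv_mul_cancel₀ (apply_ne_zero_comm hB h), one_smul, hw, add_sub_cancel]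
  · rw [happ, hx, mul_zero, zero_smul, add_zero]

theorem exists_symplectic_apply_eq (hB : B.IsAlt) (hB' : B.Nondegenerate) {u u' : V} (hu : u ≠ 0)
    (hu' : u' ≠ 0) : ∃ g ∈ symplecticGroup B, g u = u' := by
  obtain ⟨w, hw, hw'⟩ := exists_apply_ne_zero_and (exists_apply_ne_zero hB' hu)
    (exists_apply_ne_zero hB' hu')
  obtain ⟨g₁, hg₁, h₁, -⟩ := exists_symplectic_of_apply_ne_zero hB hw
  obtain ⟨g₂, hg₂, h₂, -⟩ := exists_symplectic_of_apply_ne_zero hB (apply_ne_zero_comm hB hw')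
  exact ⟨g₂ * g₁, mul_mem hg₂ hg₁, by rw [LinearEquiv.mul_apply, h₁, h₂]⟩

/-- If `v` is not a multiple of `u`, then it is not orthogonal to the whole of `u^⊥`. -/
theorem exists_orthogonal_apply_ne_zero (hB' : B.Nondegenerate) {u v : V} (hu : u ≠ 0)
    (huv : LinearIndependent K ![u, v]) :
    ∃ x, (B v).domRestrict (LinearMap.ker (B u)) x ≠ 0 := by
  by_contra! h
  obtain ⟨z, hz⟩ := exists_apply_ne_zero hB' hu
  have h1 : v - ((B u z)⁻¹ * B v z) • u = 0 := by
    refine hB'.1 _ fun x => ?_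
    have h2 : x - (B u x * (B u z)⁻¹) • z ∈ LinearMap.ker (B u) := by
      rw [LinearMap.mem_ker, map_sub, map_smul, smul_eq_mul, inv_mul_cancel_right₀ hz, sub_self]
    have h3 : B v (x - (B u x * (B u z)⁻¹) • z) = 0 := h ⟨_, h2⟩
    rw [map_sub, map_smul, smul_eq_mul] at h3
    rw [map_sub, map_smul, LinearMap.sub_apply, LinearMap.smul_apply, smul_eq_mul, ← h3]
    ring
  have h4 := LinearIndependent.pair_iff.mp huv (-((B u z)⁻¹ * B v z)) 1
    (by rw [neg_smul, one_smul, ← h1]; abel)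
  exact one_ne_zero h4.2

theorem exists_symplectic_fix_apply_eq (hB : B.IsAlt) (hB' : B.Nondegenerate) {u v v' : V}
    (huv : LinearIndependent K ![u, v]) (huv' : LinearIndependent K ![u, v'])
    (h : B u v = B u v') : ∃ g ∈ symplecticGroup B, g u = u ∧ g v = v' := by
  have hu : u ≠ 0 := huv.ne_zero 0
  have hcomm : B v u = B v' u := by rw [← hB.neg_eq, h, hB.neg_eq]
  -- it suffices to pass from `v` to `v'` through a vector `w` orthogonal to neither of them
  have key : ∀ w, B u w = B u v → B v w ≠ 0 → B w v' ≠ 0 →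
      ∃ g ∈ symplecticGroup B, g u = u ∧ g v = v' := by
    intro w hw hvw hwv'
    have hwu : B w u = B v u := by rw [← hB.neg_eq, hw, hB.neg_eq]
    obtain ⟨g₁, hg₁, h₁, h₁'⟩ := exists_symplectic_of_apply_ne_zero hB hvw
    obtain ⟨g₂, hg₂, h₂, h₂'⟩ := exists_symplectic_of_apply_ne_zero hB hwv'
    refine ⟨g₂ * g₁, mul_mem hg₂ hg₁, ?_, by rw [LinearEquiv.mul_apply, h₁, h₂]⟩
    rw [LinearEquiv.mul_apply, h₁' u, h₂' u]
    · rw [map_sub, LinearMap.sub_apply, hwu, hcomm, sub_self]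
    · rw [map_sub, LinearMap.sub_apply, hwu, sub_self]
  by_cases hvv' : B v v' = 0
  · by_cases hc : B u v = 0
    · obtain ⟨⟨w, hw⟩, h1, h2⟩ := exists_apply_ne_zero_and
        (exists_orthogonal_apply_ne_zero hB' hu huv) (exists_orthogonal_apply_ne_zero hB' hu huv')
      exact key w (by rw [hc]; exact hw) h1 (apply_ne_zero_comm hB h2)
    · refine key (v + u) ?_ ?_ ?_
      · rw [map_add, hB u, add_zero]
      · rw [map_add, hB v, zero_add]
        exact apply_ne_zero_comm hB hc
      · rwa [map_add, LinearMap.add_apply, hvv', zero_add, ← h]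
  · obtain ⟨g, hg, h1, h2⟩ := exists_symplectic_of_apply_ne_zero hB hvv'
    exact ⟨g, hg, h2 u (by rw [map_sub, LinearMap.sub_apply, hcomm, sub_self]), h1⟩

theorem linearIndependent_pair_map (g : V ≃ₗ[K] V) {u v : V} (h : LinearIndependent K ![u, v]) :
    LinearIndependent K ![g u, g v] := by
  rw [LinearIndependent.pair_iff] at h ⊢
  intro s t hst
  rw [← map_smul, ← map_smul, ← map_add, LinearEquiv.map_eq_zero_iff] at hst
  exact h s t hst

/-- Witt's theorem for pairs of vectors. -/
theorem exists_symplectic_apply_pair_eq (hB : B.IsAlt) (hB' : B.Nondegenerate) {u v u' v' : V}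
    (huv : LinearIndependent K ![u, v]) (huv' : LinearIndependent K ![u', v'])
    (h : B u v = B u' v') : ∃ g ∈ symplecticGroup B, g u = u' ∧ g v = v' := by
  obtain ⟨g₁, hg₁, rfl⟩ := exists_symplectic_apply_eq hB hB' (huv.ne_zero 0) (huv'.ne_zero 0)
  obtain ⟨g₂, hg₂, h₂, h₂'⟩ := exists_symplectic_fix_apply_eq hB hB'
    (linearIndependent_pair_map g₁ huv) huv' ((hg₁ u v).trans h)
  exact ⟨g₂ * g₁, mul_mem hg₂ hg₁, h₂, h₂'⟩

end Witt

/-! ### Totally isotropic lines and their orbits -/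

section Lines

variable {k K V : Type*} [Field k] [Field K] [Algebra k K] [AddCommGroup V]
  [Module K V] [Module k V] [IsScalarTower k K V] {B : LinearMap.BilinForm K V}

omit [Field K] [Algebra k K] [Module K V] [IsScalarTower k K V] in
theorem exists_eq_span_pair {l : Submodule k V} (hl : Module.finrank k l = 2) :
    ∃ u v, LinearIndependent k ![u, v] ∧ l = Submodule.span k {u, v} := by
  have := Module.finite_of_finrank_pos (by omega : 0 < Module.finrank k l)
  let b := Module.finBasisOfFinrankEq k l hl
  have hb : ![(b 0 : V), (b 1 : V)] = l.subtype ∘ b := by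
    ext i
    fin_cases i <;> rfl
  refine ⟨b 0, b 1, ?_, ?_⟩
  · rw [hb]
    exact b.linearIndependent.map' _ (Submodule.ker_subtype l)
  · have hr : ({(b 0 : V), (b 1 : V)} : Set V) = Set.range (l.subtype ∘ b) := by
      rw [← hb, Matrix.range_cons, Matrix.range_cons, Matrix.range_empty, Set.union_empty,
        Set.singleton_union]
    rw [hr, Set.range_comp, ← Submodule.map_span, b.span_eq, Submodule.map_top,
      Submodule.range_subtype]

omit [Field K] [Algebra k K] [Module K V] [IsScalarTower k K V] in
theorem finrank_span_pair {u v : V} (h : LinearIndependent k ![u, v]) :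
    Module.finrank k (Submodule.span k {u, v}) = 2 := by
  have h1 := finrank_span_eq_card h
  rwa [Matrix.range_cons, Matrix.range_cons, Matrix.range_empty, Set.union_empty,
    Set.singleton_union, Fintype.card_fin] at h1

omit [Field K] [Algebra k K] [Module K V] [IsScalarTower k K V] in
theorem eq_span_pair {l : Submodule k V} (hl : Module.finrank k l = 2) {u v : V}
    (h : LinearIndependent k ![u, v]) (hu : u ∈ l) (hv : v ∈ l) : l = Submodule.span k {u, v} := by
  have := Module.finite_of_finrank_pos (by omega : 0 < Module.finrank k l)
  refine (Submodule.eq_of_le_of_finrank_eq ?_ (by rw [finrank_span_pair h, hl])).symm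
  rw [Submodule.span_le, Set.insert_subset_iff, Set.singleton_subset_iff]
  exact ⟨hu, hv⟩

theorem linearIndependent_restrictScalars {u v : V} (h : LinearIndependent K ![u, v]) :
    LinearIndependent k ![u, v] := by
  refine h.restrict_scalars fun s t hst => ?_
  simpa [Algebra.smul_def] using hst

theorem finrank_spreadLine (hK : Module.finrank k K = 2) {w : V} (hw : w ≠ 0) :
    Module.finrank k ((Submodule.span K {w}).restrictScalars k) = 2 := by
  have h1 := Module.finrank_mul_finrank k K (Submodule.span K {w})
  rw [finrank_span_singleton hw, hK, mul_one] at h1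
  exact h1.symm

theorem mem_spread_iff (hK : Module.finrank k K = 2) {l : Submodule k V}
    (hl : Module.finrank k l = 2) {u v : V} (h : LinearIndependent k ![u, v]) (hu : u ∈ l)
    (hv : v ∈ l) : l ∈ spread k K V ↔ ¬ LinearIndependent K ![u, v] := by
  constructor
  · rintro ⟨w, -, rfl⟩
    exact not_linearIndependent_of_mem_span hu hv
  · intro h'
    obtain ⟨w, hu', hv'⟩ := exists_mem_span_of_not_linearIndependent h'
    have hw : w ≠ 0 := by
      rintro rfl
      rw [Submodule.span_zero_singleton, Submodule.mem_bot] at hu'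
      exact h.ne_zero 0 hu'
    refine ⟨w, hw, ?_⟩
    rw [eq_span_pair hl h hu hv]
    exact (eq_span_pair (finrank_spreadLine hK hw) h hu' hv').symm

theorem apply_mem_span_pair (hB : B.IsAlt) {u v x y : V} (hx : x ∈ Submodule.span k {u, v})
    (hy : y ∈ Submodule.span k {u, v}) : ∃ t : k, B x y = t • B u v := by
  obtain ⟨s, t, rfl⟩ := Submodule.mem_span_pair.mp hx
  obtain ⟨s', t', rfl⟩ := Submodule.mem_span_pair.mp hy
  refine ⟨s * t' - t * s', ?_⟩
  simp only [← algebraMap_smul K s, ← algebraMap_smul K t, ← algebraMap_smul K s',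
    ← algebraMap_smul K t', ← algebraMap_smul K (s * t' - t * s'), map_add, map_smul,
    LinearMap.add_apply, LinearMap.smul_apply, hB u, hB v, ← hB.neg_eq u v, smul_eq_mul, map_sub,
    map_mul]
  ring

theorem span_pair_mem_isotropicLines (hB : B.IsAlt) {a : K} {u v : V}
    (h : LinearIndependent k ![u, v]) (huv : Algebra.trace k K (a * B u v) = 0) :
    Submodule.span k {u, v} ∈ isotropicLines (pencilForm k B a) := by
  refine ⟨finrank_span_pair h, fun x hx y hy => ?_⟩
  obtain ⟨t, ht⟩ := apply_mem_span_pair hB hx hy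
  rw [pencilForm_apply, ht, mul_smul_comm, map_smul, huv, smul_zero]

theorem exists_mem_ne_zero_of_inf_ne_bot {l : Submodule k V} {m : Submodule k V}
    (hm : m ∈ spread k K V) (h : l ⊓ m ≠ ⊥) :
    ∃ w ∈ l, w ≠ 0 ∧ m = (Submodule.span K {w}).restrictScalars k := by
  obtain ⟨z, hz, rfl⟩ := hm
  obtain ⟨w, ⟨hw, hw'⟩, hw0⟩ := Submodule.exists_mem_ne_zero_of_ne_bot h
  refine ⟨w, hw, hw0, ?_⟩
  obtain ⟨c, rfl⟩ := Submodule.mem_span_singleton.mp (Submodule.restrictScalars_mem k _ _ |>.mp hw')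
  have hc : c ≠ 0 := by
    rintro rfl
    exact hw0 (zero_smul _ _)
  rw [Submodule.span_singleton_smul_eq (IsUnit.mk0 c hc)]

theorem spreadLine_mem_spread {w : V} (hw : w ≠ 0) :
    (Submodule.span K {w}).restrictScalars k ∈ spread k K V := ⟨w, hw, rfl⟩

theorem inf_spreadLine_ne_bot {l : Submodule k V} {w : V} (hw : w ≠ 0) (hwl : w ∈ l) :
    l ⊓ (Submodule.span K {w}).restrictScalars k ≠ ⊥ := by
  intro h
  have : w ∈ l ⊓ (Submodule.span K {w}).restrictScalars k :=
    ⟨hwl, Submodule.mem_span_singleton_self w⟩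
  rw [h] at this
  exact hw this

variable [Fintype k]

theorem conjugate_spreadLine_iff (hK : Module.finrank k K = 2) {a : K} (ha : a ≠ 0)
    {l : Submodule k V} {w : V} :
    Conjugate (pencilForm k B a) l ((Submodule.span K {w}).restrictScalars k) ↔
      ∀ x ∈ l, B x w = 0 := by
  simp only [Conjugate, Submodule.restrictScalars_mem, Submodule.mem_span_singleton,
    forall_exists_index, forall_apply_eq_imp_iff, forall_pencilForm_smul_eq_zero hK ha]

/-- The lines outside the spread that are conjugate to each spread line that they meet are those on
which `B` itself vanishes. -/
theorem mem_lineSetTwo_iff (hK : Module.finrank k K = 2) (hB : B.IsAlt) {a : K} (ha : a ≠ 0)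
    {l : Submodule k V} : l ∈ lineSetTwo k B a ↔
      ∃ u v, LinearIndependent K ![u, v] ∧ B u v = 0 ∧ l = Submodule.span k {u, v} := by
  constructor
  · rintro ⟨⟨hl, -⟩, hls, hl'⟩
    obtain ⟨u, v, huv, rfl⟩ := exists_eq_span_pair hl
    have hu : u ∈ Submodule.span k {u, v} := Submodule.mem_span_of_mem (by simp)
    have hv : v ∈ Submodule.span k {u, v} := Submodule.mem_span_of_mem (by simp)
    refine ⟨u, v, ?_, ?_, rfl⟩
    · rwa [mem_spread_iff hK hl huv hu hv, not_not] at hls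
    · have h1 := hl' _ (spreadLine_mem_spread (huv.ne_zero 1))
        (inf_spreadLine_ne_bot (huv.ne_zero 1) hv)
      exact (conjugate_spreadLine_iff hK ha).mp h1 u hu
  · rintro ⟨u, v, huv, h, rfl⟩
    have huv' := linearIndependent_restrictScalars (k := k) huv
    refine ⟨span_pair_mem_isotropicLines hB huv' (by rw [h, mul_zero, map_zero]), ?_, ?_⟩
    · rw [mem_spread_iff hK (finrank_span_pair huv') huv' (Submodule.mem_span_of_mem (by simp))
        (Submodule.mem_span_of_mem (by simp)), not_not]
      exact huv
    · intro m hm hlm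
      obtain ⟨w, hw, -, rfl⟩ := exists_mem_ne_zero_of_inf_ne_bot hm hlm
      refine (conjugate_spreadLine_iff hK ha).mpr fun x hx => ?_
      obtain ⟨t, ht⟩ := apply_mem_span_pair hB hx hw
      rw [ht, h, smul_zero]

/-- The totally isotropic lines that are conjugate to no spread line that they meet are those on
which `B` does not vanish; they are automatically outside the spread. -/
theorem mem_lineSetOne_iff (hK : Module.finrank k K = 2) (hB : B.IsAlt) {a : K} (ha : a ≠ 0)
    {l : Submodule k V} : l ∈ lineSetOne k B a ↔
      ∃ u v, B u v ≠ 0 ∧ Algebra.trace k K (a * B u v) = 0 ∧ l = Submodule.span k {u, v} := by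
  constructor
  · rintro ⟨⟨hl, hiso⟩, hls, hl'⟩
    obtain ⟨u, v, huv, rfl⟩ := exists_eq_span_pair hl
    have hu : u ∈ Submodule.span k {u, v} := Submodule.mem_span_of_mem (by simp)
    have hv : v ∈ Submodule.span k {u, v} := Submodule.mem_span_of_mem (by simp)
    refine ⟨u, v, fun h => ?_, hiso u hu v hv, rfl⟩
    have hv0 : v ≠ 0 := huv.ne_zero 1
    refine hl' _ (spreadLine_mem_spread hv0) (inf_spreadLine_ne_bot hv0 hv) ?_
    refine (conjugate_spreadLine_iff hK ha).mpr fun x hx => ?_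
    obtain ⟨t, ht⟩ := apply_mem_span_pair hB hx hv
    rw [ht, h, smul_zero]
  · rintro ⟨u, v, h, htr, rfl⟩
    have huv := linearIndependent_of_apply_ne_zero hB h
    have huv' := linearIndependent_restrictScalars (k := k) huv
    have hu : u ∈ Submodule.span k {u, v} := Submodule.mem_span_of_mem (by simp)
    have hv : v ∈ Submodule.span k {u, v} := Submodule.mem_span_of_mem (by simp)
    refine ⟨span_pair_mem_isotropicLines hB huv' htr, ?_, ?_⟩
    · rw [mem_spread_iff hK (finrank_span_pair huv') huv' hu hv, not_not]
      exact huv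
    · intro m hm hlm hconj
      obtain ⟨w, hw, hw0, rfl⟩ := exists_mem_ne_zero_of_inf_ne_bot hm hlm
      have h0 := (conjugate_spreadLine_iff hK ha).mp hconj
      have hwu := h0 u hu
      have hwv := h0 v hv
      -- `w = s u + t v` is orthogonal to `u` and `v`, which form a basis of a nondegenerate plane
      obtain ⟨s, t, rfl⟩ := Submodule.mem_span_pair.mp hw
      rw [← algebraMap_smul K s, ← algebraMap_smul K t, map_add, map_smul, map_smul, hB u,
        smul_zero, zero_add, smul_eq_mul, mul_eq_zero, or_iff_left h, map_eq_zero] at hwu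
      rw [← algebraMap_smul K s, ← algebraMap_smul K t, map_add, map_smul, map_smul, hB v,
        smul_zero, add_zero, smul_eq_mul, mul_eq_zero, or_iff_left (apply_ne_zero_comm hB h),
        map_eq_zero] at hwv
      exact hw0 (by rw [hwu, hwv, zero_smul, zero_smul, add_zero])

omit [Fintype k] in
theorem map_span_pair (g : V ≃ₗ[K] V) (u v : V) :
    (Submodule.span k {u, v}).map ((g : V →ₗ[K] V).restrictScalars k) =
      Submodule.span k {g u, g v} := by
  rw [Submodule.map_span, Set.image_insert_eq, Set.image_singleton]
  rfl

omit [Fintype k] in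
theorem orbit_spread (hB : B.IsAlt) (hB' : B.Nondegenerate) {l : Submodule k V}
    (hl : l ∈ spread k K V) :
    {l' | ∃ g ∈ symplecticGroup B, l' = l.map ((g : V →ₗ[K] V).restrictScalars k)} =
      spread k K V := by
  obtain ⟨w, hw, rfl⟩ := hl
  have hmap : ∀ g : V ≃ₗ[K] V, ((Submodule.span K {w}).restrictScalars k).map
      ((g : V →ₗ[K] V).restrictScalars k) = (Submodule.span K {g w}).restrictScalars k := by
    intro g
    have h1 : (Submodule.span K {w}).map (g : V →ₗ[K] V) = Submodule.span K {g w} := by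
      rw [Submodule.map_span, Set.image_singleton]
      rfl
    rw [← h1]
    rfl
  ext l'
  constructor
  · rintro ⟨g, -, rfl⟩
    exact ⟨g w, g.map_ne_zero_iff.mpr hw, hmap g⟩
  · rintro ⟨w', hw', rfl⟩
    obtain ⟨g, hg, rfl⟩ := exists_symplectic_apply_eq hB hB' hw hw'
    exact ⟨g, hg, (hmap g).symm⟩

theorem orbit_lineSetTwo (hK : Module.finrank k K = 2) (hB : B.IsAlt) (hB' : B.Nondegenerate)
    {a : K} (ha : a ≠ 0) {l : Submodule k V} (hl : l ∈ lineSetTwo k B a) :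
    {l' | ∃ g ∈ symplecticGroup B, l' = l.map ((g : V →ₗ[K] V).restrictScalars k)} =
      lineSetTwo k B a := by
  obtain ⟨u, v, huv, h, rfl⟩ := (mem_lineSetTwo_iff hK hB ha).mp hl
  ext l'
  rw [mem_lineSetTwo_iff hK hB ha]
  simp only [Set.mem_ofPred_eq, map_span_pair]
  constructor
  · rintro ⟨g, hg, rfl⟩
    exact ⟨g u, g v, linearIndependent_pair_map g huv, (hg u v).trans h, rfl⟩
  · rintro ⟨u', v', huv', h', rfl⟩
    obtain ⟨g, hg, rfl, rfl⟩ := exists_symplectic_apply_pair_eq hB hB' huv huv' (h.trans h'.symm)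
    exact ⟨g, hg, rfl⟩

/-- The elements of `K` with trace zero form a one-dimensional subspace over `k`. -/
theorem exists_smul_eq_of_trace_eq_zero (hK : Module.finrank k K = 2) {x y : K} (hx0 : x ≠ 0)
    (hx : Algebra.trace k K x = 0) (hy : Algebra.trace k K y = 0) : ∃ t : k, y = t • x := by
  have h1 : ∀ z : K, Algebra.trace k K z = 0 → frob k K z = -z := by
    intro z hz
    have := algebraMap_trace_eq hK z
    rw [hz, map_zero] at this
    rw [eq_neg_iff_add_eq_zero, add_comm, this]
  obtain ⟨t, ht⟩ := mem_range_of_frob_eq hK (z := y / x)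
    (by rw [map_div₀, h1 x hx, h1 y hy, neg_div_neg_eq])
  exact ⟨t, by rw [Algebra.smul_def, ht, div_mul_cancel₀ y hx0]⟩

theorem orbit_lineSetOne (hK : Module.finrank k K = 2) (hB : B.IsAlt) (hB' : B.Nondegenerate)
    {a : K} (ha : a ≠ 0) {l : Submodule k V} (hl : l ∈ lineSetOne k B a) :
    {l' | ∃ g ∈ symplecticGroup B, l' = l.map ((g : V →ₗ[K] V).restrictScalars k)} =
      lineSetOne k B a := by
  obtain ⟨u, v, h, htr, rfl⟩ := (mem_lineSetOne_iff hK hB ha).mp hl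
  ext l'
  rw [mem_lineSetOne_iff hK hB ha]
  simp only [Set.mem_ofPred_eq, map_span_pair]
  constructor
  · rintro ⟨g, hg, rfl⟩
    have hg' : B (g u) (g v) = B u v := hg u v
    exact ⟨g u, g v, by rwa [hg'], by rwa [hg'], rfl⟩
  · rintro ⟨u', v', h', htr', rfl⟩
    -- rescale `v` by an element of `k` so that the two pairs have the same inner product
    obtain ⟨t, ht⟩ := exists_smul_eq_of_trace_eq_zero hK (mul_ne_zero ha h) htr htr'
    rw [← mul_smul_comm] at ht
    have ht' : B u' v' = t • B u v := mul_left_cancel₀ ha ht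
    have ht0 : t ≠ 0 := by
      rintro rfl
      exact h' (by rw [ht', zero_smul])
    have hBt : B u (t • v) = B u' v' := by
      rw [ht', ← algebraMap_smul K t v, map_smul, algebraMap_smul]
    obtain ⟨g, hg, rfl, rfl⟩ := exists_symplectic_apply_pair_eq hB hB'
      (linearIndependent_of_apply_ne_zero hB (hBt ▸ h')) (linearIndependent_of_apply_ne_zero hB h')
      hBt
    refine ⟨g, hg, ?_⟩
    have h1 : g (t • v) = t • g v := by
      rw [← algebraMap_smul K t v, map_smul, algebraMap_smul]
    rw [h1, Submodule.span_insert, Submodule.span_insert (g u) {g v},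
      Submodule.span_singleton_smul_eq (IsUnit.mk0 t ht0)]

theorem mem_of_mem_isotropicLines (hK : Module.finrank k K = 2) (hB : B.IsAlt)
    {a : K} (ha : a ≠ 0) {l : Submodule k V} (hl : l ∈ isotropicLines (pencilForm k B a)) :
    l ∈ spread k K V ∨ l ∈ lineSetOne k B a ∨ l ∈ lineSetTwo k B a := by
  by_cases hls : l ∈ spread k K V
  · exact Or.inl hls
  right
  obtain ⟨u, v, huv, rfl⟩ := exists_eq_span_pair hl.1
  have hu : u ∈ Submodule.span k {u, v} := Submodule.mem_span_of_mem (by simp)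
  have hv : v ∈ Submodule.span k {u, v} := Submodule.mem_span_of_mem (by simp)
  rw [mem_lineSetOne_iff hK hB ha, mem_lineSetTwo_iff hK hB ha]
  by_cases h : B u v = 0
  · rw [mem_spread_iff hK hl.1 huv hu hv, not_not] at hls
    exact Or.inr ⟨u, v, hls, h, rfl⟩
  · exact Or.inl ⟨u, v, h, hl.2 u hu v hv, rfl⟩

omit [Fintype k] in
theorem spread_subset_isotropicLines (hK : Module.finrank k K = 2) (hB : B.IsAlt) (a : K) :
    spread k K V ⊆ isotropicLines (pencilForm k B a) := by
  rintro _ ⟨w, hw, rfl⟩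
  refine ⟨finrank_spreadLine hK hw, fun x hx y hy => ?_⟩
  obtain ⟨c, rfl⟩ := Submodule.mem_span_singleton.mp hx
  obtain ⟨d, rfl⟩ := Submodule.mem_span_singleton.mp hy
  simp [pencilForm_apply, hB w]

theorem exists_trace_mul_eq_zero (hK : Module.finrank k K = 2) {a : K} (ha : a ≠ 0) :
    ∃ c : K, c ≠ 0 ∧ Algebra.trace k K (a * c) = 0 := by
  obtain ⟨ω, hω⟩ := exists_frob_ne hK
  refine ⟨a⁻¹ * (ω - frob k K ω), mul_ne_zero (inv_ne_zero ha) (sub_ne_zero.mpr hω.symm), ?_⟩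
  rw [mul_inv_cancel_left₀ ha, ← map_eq_zero (algebraMap k K), algebraMap_trace_eq hK, map_sub,
    frob_frob hK]
  ring

omit [Module k V] [IsScalarTower k K V] in
/-- Every point of `PG(V)` lies on a line on which `f_a` vanishes but `B` does not. -/
theorem exists_partner_one (hK : Module.finrank k K = 2) (hB' : B.Nondegenerate) {a : K}
    (ha : a ≠ 0) {w : V} (hw : w ≠ 0) :
    ∃ w', B w w' ≠ 0 ∧ Algebra.trace k K (a * B w w') = 0 := by
  obtain ⟨c, hc, hac⟩ := exists_trace_mul_eq_zero hK ha
  obtain ⟨z, hz⟩ := exists_apply_ne_zero hB' hw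
  refine ⟨(c * (B w z)⁻¹) • z, ?_⟩
  rw [map_smul, smul_eq_mul, inv_mul_cancel_right₀ hz]
  exact ⟨hc, hac⟩

omit [Field k] [Fintype k] [Algebra k K] [Module k V] [IsScalarTower k K V] in
/-- Every point of `PG(V)` lies on a line outside the spread on which `B` vanishes. -/
theorem exists_partner_two (hV : 3 ≤ Module.finrank K V) (B : LinearMap.BilinForm K V) {w : V}
    (hw : w ≠ 0) : ∃ w', LinearIndependent K ![w, w'] ∧ B w w' = 0 := by
  have := Module.finite_of_finrank_pos (by omega : 0 < Module.finrank K V)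
  by_contra! h
  have h1 : LinearMap.ker (B w) ≤ Submodule.span K {w} := by
    intro x hx
    by_contra hx'
    refine h x ?_ hx
    by_contra hli
    obtain ⟨z, hwz, hxz⟩ := exists_mem_span_of_not_linearIndependent hli
    obtain ⟨c, rfl⟩ := Submodule.mem_span_singleton.mp hwz
    have hc : c ≠ 0 := by
      rintro rfl
      exact hw (zero_smul _ _)
    exact hx' (by rwa [Submodule.span_singleton_smul_eq (IsUnit.mk0 c hc)])
  have h2 := Submodule.finrank_mono h1
  have h3 := LinearMap.finrank_range_add_finrank_ker (B w)
  have h4 := Submodule.finrank_le (LinearMap.range (B w))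
  rw [finrank_span_singleton hw] at h2
  rw [Module.finrank_self] at h4
  omega

end Lines

/-! ### Points on the extended lines of the three orbits -/

section HermitianPoints

variable {k K V : Type*} [Field k] [Fintype k] [Field K] [Algebra k K] [AddCommGroup V]
  [Module K V] [Module k V] [IsScalarTower k K V] {B : LinearMap.BilinForm K V}

theorem isSkewHermitian_hermitianForm (hK : Module.finrank k K = 2) (hB : B.IsAlt) (b : K) :
    IsSkewHermitian k (hermitianForm k B b) :=
  isSkewHermitian_tensorForm hK (pencilForm_isAlt hB b)

theorem mk_mem_hermitianPoints_iff (hK : Module.finrank k K = 2) (hB : B.IsAlt) {b : K}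
    {L : Set (Submodule k V)} {x : K ⊗[k] V} (hx : x ≠ 0) :
    Projectivization.mk K x hx ∈ hermitianPoints k B b L ↔
      hermitianForm k B b x x = 0 ∧ ∃ l ∈ L, x ∈ l.baseChange K := by
  simp only [hermitianPoints, isotropicPoints, extendedPoints, Set.mem_inter_iff,
    Set.mem_ofPred_eq, (isSkewHermitian_hermitianForm hK hB b).orthogonal_mk,
    Projectivization.submodule_mk, Submodule.span_singleton_le_iff_mem]

theorem mk_mem_hermitianPoints_spread_iff (hK : Module.finrank k K = 2) (hB : B.IsAlt) {b : K}
    {x : K ⊗[k] V} (hx : x ≠ 0) :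
    Projectivization.mk K x hx ∈ hermitianPoints k B b (spread k K V) ↔
      x ∈ spreadCone k K V K := by
  rw [mk_mem_hermitianPoints_iff hK hB]
  obtain ⟨ω, hω⟩ := exists_frob_ne hK
  obtain ⟨u, v, rfl⟩ := exists_eq_tensorPair hK hω x
  simp only [hermitianForm_self_eq_zero hB hω, tensorPair_mem_baseChange hK hω,
    tensorPair_mem_spreadCone K hK hω]
  constructor
  · rintro ⟨-, _, ⟨w, -, rfl⟩, hu, hv⟩
    exact not_linearIndependent_of_mem_span hu hv
  · intro h
    obtain ⟨w, hu, hv⟩ := exists_mem_span_of_not_linearIndependent h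
    have hw : w ≠ 0 := by
      rintro rfl
      rw [Submodule.span_zero_singleton, Submodule.mem_bot] at hu hv
      exact hx (by rw [hu, hv, tensorPair_zero])
    have hiso := (spread_subset_isotropicLines hK hB b (spreadLine_mem_spread hw)).2 u hu v hv
    exact ⟨hiso, _, spreadLine_mem_spread hw, hu, hv⟩

omit [Fintype k] [Field K] [Algebra k K] [Module K V] [IsScalarTower k K V] in
theorem exists_ne_zero_mem_span_of_not_linearIndependent {u v : V} (huv : ¬ (u = 0 ∧ v = 0))
    (h : ¬ LinearIndependent k ![u, v]) :
    ∃ w, w ≠ 0 ∧ ∀ w', u ∈ Submodule.span k {w, w'} ∧ v ∈ Submodule.span k {w, w'} := by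
  obtain ⟨w, hu, hv⟩ := exists_mem_span_of_not_linearIndependent h
  refine ⟨w, ?_, fun w' => ?_⟩
  · rintro rfl
    rw [Submodule.span_zero_singleton, Submodule.mem_bot] at hu hv
    exact huv ⟨hu, hv⟩
  · have : Submodule.span k {w} ≤ Submodule.span k {w, w'} := Submodule.span_mono (by simp)
    exact ⟨this hu, this hv⟩

theorem mk_mem_hermitianPoints_lineSetTwo_iff (hK : Module.finrank k K = 2)
    (hV : 3 ≤ Module.finrank K V) (hB : B.IsAlt) {a b : K} (ha : a ≠ 0) {x : K ⊗[k] V}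
    (hx : x ≠ 0) :
    Projectivization.mk K x hx ∈ hermitianPoints k B b (lineSetTwo k B a) ↔
      x ∈ (pencilCone k B \ spreadCone k K V K) ∪ spreadCone k K V k := by
  rw [mk_mem_hermitianPoints_iff hK hB]
  obtain ⟨ω, hω⟩ := exists_frob_ne hK
  obtain ⟨u, v, rfl⟩ := exists_eq_tensorPair hK hω x
  have huv : ¬ (u = 0 ∧ v = 0) := fun h => hx (by rw [h.1, h.2, tensorPair_zero])
  simp only [hermitianForm_self_eq_zero hB hω, tensorPair_mem_baseChange hK hω, Set.mem_union,
    Set.mem_sdiff, tensorPair_mem_spreadCone _ hK hω, tensorPair_mem_pencilCone hK hB hω, not_not]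
  constructor
  · rintro ⟨-, l, hl, hu, hv⟩
    by_cases hli : LinearIndependent k ![u, v]
    · have hls : l ∉ spread k K V := hl.2.1
      rw [mem_spread_iff hK hl.1.1 hli hu hv, not_not] at hls
      obtain ⟨u', v', -, h, rfl⟩ := (mem_lineSetTwo_iff hK hB ha).mp hl
      obtain ⟨t, ht⟩ := apply_mem_span_pair hB hu hv
      exact Or.inl ⟨by rw [ht, h, smul_zero], hls⟩
    · exact Or.inr hli
  · rintro (⟨h, hli⟩ | hli)
    · refine ⟨by rw [h, mul_zero, map_zero], Submodule.span k {u, v},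
        (mem_lineSetTwo_iff hK hB ha).mpr ⟨u, v, hli, h, rfl⟩,
        Submodule.mem_span_of_mem (by simp), Submodule.mem_span_of_mem (by simp)⟩
    · obtain ⟨w, hw, hmem⟩ := exists_ne_zero_mem_span_of_not_linearIndependent huv hli
      obtain ⟨w', hww', h⟩ := exists_partner_two hV B hw
      obtain ⟨t, ht⟩ := apply_mem_span_pair hB (hmem w').1 (hmem w').2
      exact ⟨by rw [ht, h, smul_zero, mul_zero, map_zero], Submodule.span k {w, w'},
        (mem_lineSetTwo_iff hK hB ha).mpr ⟨w, w', hww', h, rfl⟩, hmem w'⟩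

theorem mk_mem_hermitianPoints_lineSetOne_iff (hK : Module.finrank k K = 2) (hB : B.IsAlt)
    (hB' : B.Nondegenerate) {a : K} (ha : a ≠ 0) {x : K ⊗[k] V} (hx : x ≠ 0) :
    Projectivization.mk K x hx ∈ hermitianPoints k B a (lineSetOne k B a) ↔
      x ∈ ({x | hermitianForm k B a x x = 0} \ pencilCone k B) ∪ spreadCone k K V k := by
  rw [mk_mem_hermitianPoints_iff hK hB]
  obtain ⟨ω, hω⟩ := exists_frob_ne hK
  obtain ⟨u, v, rfl⟩ := exists_eq_tensorPair hK hω x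
  have huv : ¬ (u = 0 ∧ v = 0) := fun h => hx (by rw [h.1, h.2, tensorPair_zero])
  simp only [hermitianForm_self_eq_zero hB hω, tensorPair_mem_baseChange hK hω, Set.mem_union,
    Set.mem_sdiff, tensorPair_mem_spreadCone _ hK hω, tensorPair_mem_pencilCone hK hB hω,
    Set.mem_ofPred_eq]
  constructor
  · rintro ⟨htr, l, hl, hu, hv⟩
    by_cases hli : LinearIndependent k ![u, v]
    · refine Or.inl ⟨htr, fun h => ?_⟩
      have hluv := eq_span_pair hl.1.1 hli hu hv
      obtain ⟨u', v', h', -, rfl⟩ := (mem_lineSetOne_iff hK hB ha).mp hl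
      have hu' : u' ∈ Submodule.span k {u, v} := hluv ▸ Submodule.mem_span_of_mem (by simp)
      have hv' : v' ∈ Submodule.span k {u, v} := hluv ▸ Submodule.mem_span_of_mem (by simp)
      obtain ⟨t, ht⟩ := apply_mem_span_pair hB hu' hv'
      exact h' (by rw [ht, h, smul_zero])
    · exact Or.inr hli
  · rintro (⟨htr, h⟩ | hli)
    · exact ⟨htr, Submodule.span k {u, v}, (mem_lineSetOne_iff hK hB ha).mpr ⟨u, v, h, htr, rfl⟩,
        Submodule.mem_span_of_mem (by simp), Submodule.mem_span_of_mem (by simp)⟩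
    · obtain ⟨w, hw, hmem⟩ := exists_ne_zero_mem_span_of_not_linearIndependent huv hli
      obtain ⟨w', hww', h⟩ := exists_partner_one hK hB' ha hw
      obtain ⟨t, ht⟩ := apply_mem_span_pair hB (hmem w').1 (hmem w').2
      exact ⟨by rw [ht, mul_smul_comm, map_smul, h, smul_zero], Submodule.span k {w, w'},
        (mem_lineSetOne_iff hK hB ha).mpr ⟨w, w', hww', h, rfl⟩, hmem w'⟩

omit [Fintype k] [Module K V] [IsScalarTower k K V] in
theorem zero_mem_spreadCone (F : Type*) [Field F] [Algebra k F] [Module F V]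
    [IsScalarTower k F V] : (0 : K ⊗[k] V) ∈ spreadCone k K V F := ⟨0, zero_mem _⟩

theorem spreadCone_self_subset (hK : Module.finrank k K = 2) :
    spreadCone k K V k ⊆ spreadCone k K V K := by
  intro x
  obtain ⟨ω, hω⟩ := exists_frob_ne hK
  obtain ⟨u, v, rfl⟩ := exists_eq_tensorPair hK hω x
  rw [tensorPair_mem_spreadCone _ hK hω, tensorPair_mem_spreadCone _ hK hω]
  exact mt linearIndependent_restrictScalars

theorem spreadCone_subset_pencilCone (hK : Module.finrank k K = 2) (hB : B.IsAlt) :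
    spreadCone k K V K ⊆ pencilCone k B := by
  intro x
  obtain ⟨ω, hω⟩ := exists_frob_ne hK
  obtain ⟨u, v, rfl⟩ := exists_eq_tensorPair hK hω x
  rw [tensorPair_mem_spreadCone _ hK hω, tensorPair_mem_pencilCone hK hB hω]
  intro h
  by_contra h'
  exact h (linearIndependent_of_apply_ne_zero hB h')

end HermitianPoints

/-! ### The three orbits -/

section Orbits

variable {k K V : Type*} [Field k] [Fintype k] [Field K] [Algebra k K] [AddCommGroup V]
  [Module K V] [Module k V] [IsScalarTower k K V] {B : LinearMap.BilinForm K V}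

theorem lineSetOne_nonempty (hK : Module.finrank k K = 2) (hB : B.IsAlt) (hB' : B.Nondegenerate)
    [Nontrivial V] {a : K} (ha : a ≠ 0) : (lineSetOne k B a).Nonempty := by
  obtain ⟨w, hw⟩ := exists_ne (0 : V)
  obtain ⟨w', h, h'⟩ := exists_partner_one hK hB' ha hw
  exact ⟨_, (mem_lineSetOne_iff hK hB ha).mpr ⟨w, w', h, h', rfl⟩⟩

theorem lineSetTwo_nonempty (hK : Module.finrank k K = 2) (hV : 3 ≤ Module.finrank K V)
    (hB : B.IsAlt) {a : K} (ha : a ≠ 0) : (lineSetTwo k B a).Nonempty := by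
  have := Module.nontrivial_of_finrank_pos (by omega : 0 < Module.finrank K V)
  obtain ⟨w, hw⟩ := exists_ne (0 : V)
  obtain ⟨w', h, h'⟩ := exists_partner_two hV B hw
  exact ⟨_, (mem_lineSetTwo_iff hK hB ha).mpr ⟨w, w', h, h', rfl⟩⟩

theorem lineSetOne_ne_lineSetTwo (hK : Module.finrank k K = 2) (hB : B.IsAlt)
    (hB' : B.Nondegenerate) [Nontrivial V] {a : K} (ha : a ≠ 0) :
    lineSetOne k B a ≠ lineSetTwo k B a := by
  intro h
  obtain ⟨l, hl⟩ := lineSetOne_nonempty hK hB hB' ha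
  have hl' : l ∈ lineSetTwo k B a := h ▸ hl
  obtain ⟨u, v, huv, rfl⟩ := exists_eq_span_pair hl.1.1
  have hu0 : u ≠ 0 := huv.ne_zero 0
  have h1 := spreadLine_mem_spread (k := k) (K := K) hu0
  have h2 := inf_spreadLine_ne_bot (k := k) (K := K) hu0
    (l := Submodule.span k {u, v}) (Submodule.mem_span_of_mem (by simp))
  exact hl.2.2 _ h1 h2 (hl'.2.2 _ h1 h2)

theorem isotropicLineOrbits_eq (hK : Module.finrank k K = 2) (hV : 3 ≤ Module.finrank K V)
    (hB : B.IsAlt) (hB' : B.Nondegenerate) {a : K} (ha : a ≠ 0) :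
    isotropicLineOrbits k B a = {spread k K V, lineSetOne k B a, lineSetTwo k B a} := by
  have := Module.nontrivial_of_finrank_pos (by omega : 0 < Module.finrank K V)
  ext O
  simp only [isotropicLineOrbits, Set.mem_ofPred_eq, Set.mem_insert_iff, Set.mem_singleton_iff]
  constructor
  · rintro ⟨l, hl, rfl⟩
    rcases mem_of_mem_isotropicLines hK hB ha hl with h | h | h
    · exact Or.inl (orbit_spread hB hB' h)
    · exact Or.inr (Or.inl (orbit_lineSetOne hK hB hB' ha h))
    · exact Or.inr (Or.inr (orbit_lineSetTwo hK hB hB' ha h))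
  · rintro (rfl | rfl | rfl)
    · obtain ⟨w, hw⟩ := exists_ne (0 : V)
      exact ⟨_, spread_subset_isotropicLines hK hB a (spreadLine_mem_spread hw),
        (orbit_spread hB hB' (spreadLine_mem_spread hw)).symm⟩
    · obtain ⟨l, hl⟩ := lineSetOne_nonempty hK hB hB' ha
      exact ⟨l, hl.1, (orbit_lineSetOne hK hB hB' ha hl).symm⟩
    · obtain ⟨l, hl⟩ := lineSetTwo_nonempty hK hV hB ha
      exact ⟨l, hl.1, (orbit_lineSetTwo hK hB hB' ha hl).symm⟩

end Orbits

/-! ### Tightness -/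

section Tight

variable {k K V : Type*} [Field k] [Fintype k] [Field K] [Algebra k K] [AddCommGroup V]
  [Module K V] [Module k V] [IsScalarTower k K V] {B : LinearMap.BilinForm K V} {n : ℕ}

omit [Module k V] [IsScalarTower k K V] in
theorem finite_of_finrank (hK : Module.finrank k K = 2) (hn : 2 ≤ n)
    (hV : Module.finrank K V = 2 * n) : Finite V := by
  have := finiteDimensional_of_finrank_two hK
  have : Finite K := Module.finite_of_finite k
  have : Module.Finite K V := Module.finite_of_finrank_pos (by omega)
  exact Module.finite_of_finite K

omit [Module k V] [IsScalarTower k K V] in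
theorem card_space [Fintype V] (hK : Module.finrank k K = 2) (hn : 2 ≤ n)
    (hV : Module.finrank K V = 2 * n) :
    (Fintype.card V : ℤ) = (Fintype.card k : ℤ) ^ 2 * (Fintype.card k : ℤ) ^ (4 * n - 2) := by
  have := finiteDimensional_of_finrank_two hK
  have : Finite K := Module.finite_of_finite k
  have := Fintype.ofFinite K
  rw [Module.card_eq_pow_finrank (K := K), card_of_finrank_two hK, hV, ← pow_add]
  push_cast
  rw [← pow_mul]
  congr 1
  omega

omit [Module K V] [IsScalarTower k K V] in
theorem finite_tensor [Finite V] (hK : Module.finrank k K = 2) : Finite (K ⊗[k] V) :=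
  Finite.of_surjective _ (tensorPair_bijective hK (exists_frob_ne hK).choose_spec).2

theorem isTight_hermitianPoints_spread (hK : Module.finrank k K = 2) (hn : 2 ≤ n)
    (hV : Module.finrank K V = 2 * n) (hB : B.IsAlt) (hB' : B.Nondegenerate) {b : K} (hb : b ≠ 0) :
    IsTight (Fintype.card k) (4 * n - 1) (hermitianForm k B b) (Fintype.card k ^ 2 + 1)
      (hermitianPoints k B b (spread k K V)) := by
  have := finite_of_finrank hK hn hV
  have := Fintype.ofFinite V
  have : Finite (K ⊗[k] V) := finite_tensor hK
  refine isTight_of_isTightCone hK (by omega) (isSkewHermitian_hermitianForm hK hB b)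
    (zero_mem_spreadCone K) Set.inter_subset_left
    (fun x hx => mk_mem_hermitianPoints_spread_iff hK hB hx) ?_
  push_cast
  exact isTightCone_spreadCone hK hB hB' hb (card_space hK hn hV)

theorem isTight_hermitianPoints_lineSetOne (hK : Module.finrank k K = 2) (hn : 2 ≤ n)
    (hV : Module.finrank K V = 2 * n) (hB : B.IsAlt) (hB' : B.Nondegenerate) {a : K} (ha : a ≠ 0) :
    IsTight (Fintype.card k) (4 * n - 1) (hermitianForm k B a)
      (Fintype.card k ^ (4 * n - 1) - Fintype.card k ^ (4 * n - 2) + Fintype.card k + 1)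
      (hermitianPoints k B a (lineSetOne k B a)) := by
  have := finite_of_finrank hK hn hV
  have := Fintype.ofFinite V
  have : Finite (K ⊗[k] V) := finite_tensor hK
  have hM := card_space hK hn hV
  have hf := pencilForm_isAlt (k := k) hB a
  have hf' := pencilForm_nondegenerate (k := k) hK hB hB' ha
  refine isTight_of_isTightCone hK (by omega) (isSkewHermitian_hermitianForm hK hB a)
    (Or.inr (zero_mem_spreadCone k)) Set.inter_subset_left
    (fun x hx => mk_mem_hermitianPoints_lineSetOne_iff hK hB hB' ha hx) ?_
  have h := (isTightCone_isotropic (K := K) hK hf hf' hM).sdiff_union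
    (isTightCone_pencilCone hK hB hB' ha hM) (isTightCone_spreadCone_self hK hf hf' hM)
    (fun x hx => hx a) ((spreadCone_self_subset hK).trans (spreadCone_subset_pencilCone hK hB))
  convert! h using 1
  have hle : Fintype.card k ^ (4 * n - 2) ≤ Fintype.card k ^ (4 * n - 1) :=
    Nat.pow_le_pow_right Fintype.card_pos (by omega)
  have hsucc : 4 * n - 1 = 4 * n - 2 + 1 := by omega
  push_cast [Nat.cast_sub hle]
  rw [hsucc, pow_succ]
  ring

theorem isTight_hermitianPoints_lineSetTwo (hK : Module.finrank k K = 2) (hn : 2 ≤ n)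
    (hV : Module.finrank K V = 2 * n) (hB : B.IsAlt) (hB' : B.Nondegenerate) {a b : K} (ha : a ≠ 0)
    (hb : b ≠ 0) :
    IsTight (Fintype.card k) (4 * n - 1) (hermitianForm k B b)
      (Fintype.card k ^ (4 * n - 2) - Fintype.card k ^ 2 + Fintype.card k + 1)
      (hermitianPoints k B b (lineSetTwo k B a)) := by
  have := finite_of_finrank hK hn hV
  have := Fintype.ofFinite V
  have : Finite (K ⊗[k] V) := finite_tensor hK
  have hM := card_space hK hn hV
  refine isTight_of_isTightCone hK (by omega) (isSkewHermitian_hermitianForm hK hB b)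
    (Or.inr (zero_mem_spreadCone k)) Set.inter_subset_left
    (fun x hx => mk_mem_hermitianPoints_lineSetTwo_iff hK (by omega) hB ha hx) ?_
  have h := (isTightCone_pencilCone hK hB hB' hb hM).sdiff_union
    (isTightCone_spreadCone hK hB hB' hb hM)
    (isTightCone_spreadCone_self hK (pencilForm_isAlt hB b)
      (pencilForm_nondegenerate hK hB hB' hb) hM)
    (spreadCone_subset_pencilCone hK hB) (spreadCone_self_subset hK)
  convert! h using 1
  have hle : Fintype.card k ^ 2 ≤ Fintype.card k ^ (4 * n - 2) :=
    Nat.pow_le_pow_right Fintype.card_pos (by omega)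
  push_cast [Nat.cast_sub hle]
  ring

end Tight

end DyeSpread

theorem mainTheorem6 {k K V : Type*} [Field k] [Fintype k] [Field K] [Algebra k K]
    [AddCommGroup V] [Module K V] [Module k V] [IsScalarTower k K V]
    (n q : ℕ) (hn : 2 ≤ n) (hq : Fintype.card k = q)
    (hK : Module.finrank k K = 2) (hV : Module.finrank K V = 2 * n)
    (B : LinearMap.BilinForm K V) (hBalt : B.IsAlt) (hBnd : B.Nondegenerate)
    (a : K) (ha : a ≠ 0) :
    (DyeSpread.isotropicLineOrbits k B a =
        {DyeSpread.spread k K V, DyeSpread.lineSetOne k B a, DyeSpread.lineSetTwo k B a} ∧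
      DyeSpread.spread k K V ≠ DyeSpread.lineSetOne k B a ∧
      DyeSpread.spread k K V ≠ DyeSpread.lineSetTwo k B a ∧
      DyeSpread.lineSetOne k B a ≠ DyeSpread.lineSetTwo k B a) ∧
    DyeSpread.IsTight q (4 * n - 1) (DyeSpread.hermitianForm k B a)
      (q ^ (4 * n - 1) - q ^ (4 * n - 2) + q + 1)
      (DyeSpread.hermitianPoints k B a (DyeSpread.lineSetOne k B a)) ∧
    ∀ b : K, b ≠ 0 →
      DyeSpread.IsTight q (4 * n - 1) (DyeSpread.hermitianForm k B b) (q ^ 2 + 1)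
        (DyeSpread.hermitianPoints k B b (DyeSpread.spread k K V)) ∧
      DyeSpread.IsTight q (4 * n - 1) (DyeSpread.hermitianForm k B b)
        (q ^ (4 * n - 2) - q ^ 2 + q + 1)
        (DyeSpread.hermitianPoints k B b (DyeSpread.lineSetTwo k B a)) := by
  subst hq
  have hV3 : 3 ≤ Module.finrank K V := by omega
  have : Nontrivial V := Module.nontrivial_of_finrank_pos (R := K) (by omega)
  refine ⟨⟨DyeSpread.isotropicLineOrbits_eq hK hV3 hBalt hBnd ha, fun h => ?_, fun h => ?_,
    DyeSpread.lineSetOne_ne_lineSetTwo hK hBalt hBnd ha⟩,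
    DyeSpread.isTight_hermitianPoints_lineSetOne hK hn hV hBalt hBnd ha, fun b hb =>
    ⟨DyeSpread.isTight_hermitianPoints_spread hK hn hV hBalt hBnd hb,
      DyeSpread.isTight_hermitianPoints_lineSetTwo hK hn hV hBalt hBnd ha hb⟩⟩
  · obtain ⟨l, hl⟩ := DyeSpread.lineSetOne_nonempty (k := k) hK hBalt hBnd ha
    exact hl.2.1 (h ▸ hl)
  · obtain ⟨l, hl⟩ := DyeSpread.lineSetTwo_nonempty (k := k) hK hV3 hBalt ha
    exact hl.2.1 (h ▸ hl)
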